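/- Let $\Bbbk$ be a field. A nondegenerate algebra is a (not necessarily unital) algebra $B$ in which $b=0$ whenever $bB=0$ or $Bb=0$; $M(B)\supseteq B$ is its multiplier algebra (pairs $(X,X')$ of linear maps $B\to B$ with $a\,X(b)=X'(a)\,b$). Let $(A,\Delta_A)$ and $(Y,\Delta_Y)$ be nonzero regular multiplier Hopf algebras over $\Bbbk$ with counits $\varepsilon_A,\varepsilon_Y$; $\Delta_A$ and $\varepsilon_A$ also denote the extensions $M(A)\to M(A\otimes A)$, $M(A)\to\Bbbk$, and $\varepsilon_A\otimes\iota_Y$ the extension $M(A\otimes Y)\to M(Y)$. Write $\tau$ for flips of tensor factors. Let $\rho:Y\to M(A\otimes Y)$ be linear. $Y$ is a *partial $A$-comodule coalgebra* via $\rho$ if $T(y\otimes a):=\rho(y)(a\otimes 1)\in A\otimes Y$ for all $y\in Y,a\in A$, and for all $y,y'\in Y$, $a\in A$: 1. $(\varepsilon_A\otimes\iota_Y)\rho(y)=y$; 2. $\big((\iota_Y\otimes T)(\Delta_Y(y)\otimes a)\big)(1\otimes1\otimes y')$ and $(1\otimes1\otimes y')\big((\iota_Y\otimes T)(\Delta_Y(y)\otimes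 a)\big)$ lie in $Y\otimes A\otimes Y$; 3. $(\iota_A\otimes\Delta_Y)T=(T\otimes\iota_Y)(\iota_Y\otimes T)(\Delta_Y\otimes\iota_A)$; 4. $(\iota_A\otimes T)(T\otimes\iota_A)(\iota_Y\otimes\Delta_A)=((\iota_A\otimes\varepsilon_Y)T\otimes\iota_A\otimes\iota_Y)(\iota_Y\otimes(\Delta_A\otimes\iota_Y)T)(\Delta_Y\otimes\iota_A)$. It is *symmetric* if moreover $\overline T(a\otimes y):=(a\otimes1)\rho(y)\in A\otimes Y$ for all $a\in A,y\in Y$, and for all $y,y'\in Y$, $a\in A$: 5. $\big((\overline T\otimes\iota_Y)(a\otimes\Delta_Y(y))\big)(1\otimes y'\otimes1)\in A\otimes Y\otimes Y$; 6. $(\iota_A\otimes\overline T)(\iota_A\otimes\tau_{Y,A})(\overline T\otimes\iota_A)(\iota_A\otimes\tau_{A,Y})(\Delta_A\otimes\iota_Y)=((\iota_A\otimes\varepsilon_Y)\overline T\otimes\iota_A\otimes\iota_Y)(\iota_A\otimes\tau_{A\otimes Y,Y})((\Delta_A\otimes\iota_Y)\overline T\otimes\iota_Y)(\iota_A\otimes\Delta_Y)$.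 Equalities 3, 4 and 6 are equalities of multipliers, that is, they hold after multiplication by $1\otimes1\otimes y'$ on either side (3), by $1\otimes a'\otimes y'$ on the right (4), and by $1\otimes a'\otimes1$ on the left and $1\otimes1\otimes y'$ on the right (6), for all $a'\in A$, $y'\in Y$. **Proposition.** Let $h\in M(A)$ and let $\rho:Y\to M(A\otimes Y)$ be $\rho(y)=h\otimes y$. Then $Y$ is a partial $A$-comodule coalgebra via $\rho$ if and only if $$\text{(i)}\ \ \varepsilon_A(h)=1_\Bbbk\qquad\text{and}\qquad\text{(ii)}\ \ h\otimes h=(h\otimes1)\Delta_A(h).$$ Moreover, $Y$ is a symmetric partial $A$-comodule coalgebra via $\rho$ if and only if (i), (ii) and $$\text{(iii)}\ \ h\otimes h=\Delta_A(h)(h\otimes1)$$ hold. -/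

import Mathlib

open scoped TensorProduct

noncomputable section

namespace MultHopf

/-- A (possibly non-unital) algebra is nondegenerate if its product is nondegenerate on both
sides. -/
class NondegenerateAlgebra (A : Type*) [NonUnitalRing A] : Prop where
  eq_zero_of_mul_right : ∀ a : A, (∀ b : A, a * b = 0) → a = 0
  eq_zero_of_mul_left : ∀ b : A, (∀ a : A, a * b = 0) → b = 0

section Multipliers

variable (k : Type*) [Field k]
variable (A : Type*) [NonUnitalRing A] [Module k A] [IsScalarTower k A A] [SMulCommClass k A A]

/-- The multiplier algebra `M(A)`: the pairs `(X, X')` of linear maps on `A` such that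
`a * X b = X' a * b`, with product `(X, X') (Z, Z') = (X ∘ Z, Z' ∘ X')` and unit `(id, id)`. -/
def multiplierAlgebra : Subalgebra k (Module.End k A × (Module.End k A)ᵐᵒᵖ) where
  carrier := {m | ∀ a b : A, a * m.1 b = m.2.unop a * b}
  mul_mem' := by
    intro m n hm hn a b
    simp only [Set.mem_ofPred_eq] at hm hn
    simp [hm, hn]
  add_mem' := by
    intro m n hm hn a b
    simp only [Set.mem_ofPred_eq] at hm hn
    simp [mul_add, add_mul, hm, hn]
  algebraMap_mem' := by
    intro r a b
    simp [Algebra.algebraMap_eq_smul_one, mul_smul_comm, smul_mul_assoc]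

/-- The multiplier algebra as a unital `k`-algebra. -/
def Mult : Type _ := multiplierAlgebra k A

instance : Ring (Mult k A) := inferInstanceAs (Ring (multiplierAlgebra k A))

instance : Algebra k (Mult k A) := inferInstanceAs (Algebra k (multiplierAlgebra k A))

variable {k A}

/-- `m.L a` is the product `m a ∈ A` of a multiplier with an element of `A`. -/
def Mult.L (m : Mult k A) : A →ₗ[k] A := m.1.1

/-- `m.R a` is the product `a m ∈ A` of an element of `A` with a multiplier. -/
def Mult.R (m : Mult k A) : A →ₗ[k] A := m.1.2.unop

/-- The multiplier given by a compatible pair of linear maps. -/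
def Mult.mk (l r : A →ₗ[k] A) (h : ∀ a b : A, a * l b = r a * b) : Mult k A :=
  ⟨(l, MulOpposite.op r), h⟩

theorem Mult.compat (m : Mult k A) (a b : A) : a * m.L b = m.R a * b := m.2 a b

@[simp] theorem Mult.L_mk (l r : A →ₗ[k] A) (h) : (Mult.mk l r h).L = l := rfl
@[simp] theorem Mult.R_mk (l r : A →ₗ[k] A) (h) : (Mult.mk l r h).R = r := rfl
@[simp] theorem Mult.L_one : (1 : Mult k A).L = LinearMap.id := rfl
@[simp] theorem Mult.R_one : (1 : Mult k A).R = LinearMap.id := rfl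
@[simp] theorem Mult.L_zero : (0 : Mult k A).L = 0 := rfl
@[simp] theorem Mult.R_zero : (0 : Mult k A).R = 0 := rfl
@[simp] theorem Mult.L_mul (m n : Mult k A) (a : A) : (m * n).L a = m.L (n.L a) := rfl
@[simp] theorem Mult.R_mul (m n : Mult k A) (a : A) : (m * n).R a = n.R (m.R a) := rfl
@[simp] theorem Mult.L_add (m n : Mult k A) : (m + n).L = m.L + n.L := rfl
@[simp] theorem Mult.R_add (m n : Mult k A) : (m + n).R = m.R + n.R := rfl
@[simp] theorem Mult.L_smul (r : k) (m : Mult k A) : (r • m).L = r • m.L := rfl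
@[simp] theorem Mult.R_smul (r : k) (m : Mult k A) : (r • m).R = r • m.R := rfl

theorem Mult.ext' {m n : Mult k A} (h : m.L = n.L) (h' : m.R = n.R) : m = n :=
  Subtype.ext (Prod.ext h (MulOpposite.unop_injective h'))

theorem Mult.ext_L [NondegenerateAlgebra A] {m n : Mult k A} (h : m.L = n.L) : m = n := by
  refine Mult.ext' h (LinearMap.ext fun a => ?_)
  rw [← sub_eq_zero]
  refine NondegenerateAlgebra.eq_zero_of_mul_right _ fun b => ?_
  rw [sub_mul, ← Mult.compat, ← Mult.compat, h, sub_self]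

theorem Mult.L_mul_elt [NondegenerateAlgebra A] (m : Mult k A) (a b : A) :
    m.L (a * b) = m.L a * b := by
  rw [← sub_eq_zero]
  refine NondegenerateAlgebra.eq_zero_of_mul_left _ fun c => ?_
  rw [mul_sub, Mult.compat, ← mul_assoc, ← mul_assoc, Mult.compat, sub_self]

theorem Mult.R_mul_elt [NondegenerateAlgebra A] (m : Mult k A) (a b : A) :
    m.R (a * b) = a * m.R b := by
  rw [← sub_eq_zero]
  refine NondegenerateAlgebra.eq_zero_of_mul_right _ fun c => ?_
  rw [sub_mul, ← Mult.compat, mul_assoc, mul_assoc, Mult.compat, sub_self]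

variable (k A) in
/-- The canonical homomorphism `A → M(A)` sending `a` to left and right multiplication by `a`. -/
def ofElt : A →ₙₐ[k] Mult k A where
  toFun a := Mult.mk (LinearMap.mulLeft k a) (LinearMap.mulRight k a) fun x y =>
    (mul_assoc x a y).symm
  map_smul' r a := Mult.ext' (LinearMap.ext fun x => smul_mul_assoc r a x)
    (LinearMap.ext fun x => mul_smul_comm r x a)
  map_zero' := Mult.ext' (LinearMap.ext fun x => zero_mul x) (LinearMap.ext fun x => mul_zero x)
  map_add' a b := Mult.ext' (LinearMap.ext fun x => add_mul a b x)
    (LinearMap.ext fun x => mul_add x a b)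
  map_mul' a b := Mult.ext' (LinearMap.ext fun x => mul_assoc a b x)
    (LinearMap.ext fun x => (mul_assoc x a b).symm)

@[simp] theorem L_ofElt (a b : A) : (ofElt k A a).L b = a * b := rfl
@[simp] theorem R_ofElt (a b : A) : (ofElt k A a).R b = b * a := rfl

theorem ofElt_injective [NondegenerateAlgebra A] : Function.Injective (ofElt k A) := by
  intro a b h
  rw [← sub_eq_zero]
  refine NondegenerateAlgebra.eq_zero_of_mul_right _ fun c => ?_
  rw [sub_mul, ← L_ofElt (k := k), ← L_ofElt (k := k), h, sub_self]

theorem mul_ofElt [NondegenerateAlgebra A] (m : Mult k A) (a : A) :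
    m * ofElt k A a = ofElt k A (m.L a) :=
  Mult.ext_L (LinearMap.ext fun b => by simp [Mult.L_mul_elt])

theorem ofElt_mul [NondegenerateAlgebra A] (m : Mult k A) (a : A) :
    ofElt k A a * m = ofElt k A (m.R a) :=
  Mult.ext_L (LinearMap.ext fun b => by simp [Mult.compat])

/-- `a ∈ A ⊆ M(A)`, for a multiplier `m`. -/
def InAlg (m : Mult k A) : Prop := ∃ a : A, ofElt k A a = m

/-- The element of `A` underlying a multiplier that lies in `A ⊆ M(A)`. -/
def lower (m : Mult k A) (hm : InAlg m) : A := hm.choose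

theorem ofElt_lower (m : Mult k A) (hm : InAlg m) : ofElt k A (lower m hm) = m := hm.choose_spec

theorem InAlg.add {m n : Mult k A} (hm : InAlg m) (hn : InAlg n) : InAlg (m + n) := by
  obtain ⟨a, rfl⟩ := hm
  obtain ⟨b, rfl⟩ := hn
  exact ⟨a + b, map_add _ _ _⟩

/-- A linear map into `M(A)` with values in `A ⊆ M(A)`, as a linear map into `A`. -/
def descend [NondegenerateAlgebra A] {X : Type*} [AddCommGroup X] [Module k X]
    (f : X →ₗ[k] Mult k A) (hf : ∀ x, InAlg (f x)) : X →ₗ[k] A where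
  toFun x := lower (f x) (hf x)
  map_add' x y := ofElt_injective (k := k) (by simp [ofElt_lower])
  map_smul' r x := ofElt_injective (k := k) (by simp [ofElt_lower])

theorem ofElt_descend [NondegenerateAlgebra A] {X : Type*} [AddCommGroup X] [Module k X]
    (f : X →ₗ[k] Mult k A) (hf : ∀ x, InAlg (f x)) (x : X) :
    ofElt k A (descend f hf x) = f x := ofElt_lower _ _

theorem inAlg_lift {X Z : Type*} [AddCommGroup X] [Module k X] [AddCommGroup Z] [Module k Z]
    (f : X →ₗ[k] Z →ₗ[k] Mult k A) (hf : ∀ x z, InAlg (f x z)) (u : X ⊗[k] Z) :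
    InAlg (TensorProduct.lift f u) := by
  induction u with
  | zero => exact ⟨0, by simp⟩
  | add u v hu hv => rw [map_add]; exact hu.add hv
  | tmul x z => rw [TensorProduct.lift.tmul]; exact hf x z

end Multipliers

section Extension

variable {k : Type*} [Field k]
variable {A : Type*} [NonUnitalRing A] [Module k A] [IsScalarTower k A A] [SMulCommClass k A A]
variable {B : Type*} [NonUnitalRing B] [Module k B] [IsScalarTower k B B] [SMulCommClass k B B]

/-- A homomorphism `f : A → M(B)` is nondegenerate if `f(A) B` and `B f(A)` both span `B`. -/
structure IsNondegenerateHom (f : A →ₙₐ[k] Mult k B) : Prop where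
  span_left : Submodule.span k {x : B | ∃ (a : A) (b : B), x = (f a).L b} = ⊤
  span_right : Submodule.span k {x : B | ∃ (a : A) (b : B), x = (f a).R b} = ⊤

theorem exists_extension_apply [NondegenerateAlgebra A] [NondegenerateAlgebra B]
    {f : A →ₙₐ[k] Mult k B} (hf : IsNondegenerateHom f) (m : Mult k A) :
    ∃ F : Mult k B, ∀ a, F * f a = f (m.L a) := by
  -- multiplication maps `A ⊗ B → B`
  let φ : A ⊗[k] B →ₗ[k] B := TensorProduct.lift
    (LinearMap.mk₂ k (fun a b => (f a).L b) (by simp) (by simp) (by simp) (by simp))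
  let ψ : A ⊗[k] B →ₗ[k] B := TensorProduct.lift
    (LinearMap.mk₂ k (fun a b => (f a).R b) (by simp) (by simp) (by simp) (by simp))
  have hφ : LinearMap.range φ = ⊤ := by
    rw [eq_top_iff, ← hf.span_left, Submodule.span_le]
    rintro _ ⟨a, b, rfl⟩
    exact ⟨a ⊗ₜ b, by simp [φ]⟩
  have hψ : LinearMap.range ψ = ⊤ := by
    rw [eq_top_iff, ← hf.span_right, Submodule.span_le]
    rintro _ ⟨a, b, rfl⟩
    exact ⟨a ⊗ₜ b, by simp [ψ]⟩
  have key : ∀ u v, ψ v * φ (m.L.rTensor B u) = ψ (m.R.rTensor B v) * φ u := by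
    intro u v
    induction u with
    | zero => simp
    | add x y hx hy => simp only [map_add, mul_add, hx, hy]
    | tmul a b =>
      induction v with
      | zero => simp
      | add x y hx hy => simp only [map_add, add_mul, hx, hy]
      | tmul c d =>
        simp only [φ, ψ, LinearMap.rTensor_tmul, TensorProduct.lift.tmul, LinearMap.mk₂_apply]
        rw [← Mult.compat, ← Mult.compat, ← Mult.L_mul, ← Mult.L_mul, ← map_mul, ← map_mul,
          Mult.compat m]
  obtain ⟨s, hs⟩ := φ.exists_rightInverse_of_surjective hφ
  obtain ⟨t, ht⟩ := ψ.exists_rightInverse_of_surjective hψ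
  have hs' : ∀ b, φ (s b) = b := fun b => LinearMap.congr_fun hs b
  have ht' : ∀ b, ψ (t b) = b := fun b => LinearMap.congr_fun ht b
  refine ⟨Mult.mk (φ ∘ₗ m.L.rTensor B ∘ₗ s) (ψ ∘ₗ m.R.rTensor B ∘ₗ t) ?_, fun a => ?_⟩
  · intro b c
    have := key (s c) (t b)
    rw [hs', ht'] at this
    exact this
  · refine Mult.ext_L (LinearMap.ext fun b => ?_)
    have h1 : (f a).L b = φ (a ⊗ₜ b) := by simp [φ]
    have h2 : (f (m.L a)).L b = φ (m.L.rTensor B (a ⊗ₜ b)) := by simp [φ]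
    rw [Mult.L_mul, h2, h1, Mult.L_mk]
    simp only [LinearMap.comp_apply]
    rw [← sub_eq_zero, ← map_sub, ← map_sub]
    refine NondegenerateAlgebra.eq_zero_of_mul_left _ fun c => ?_
    rw [← ht' c, key, map_sub, hs', sub_self, mul_zero]

theorem eq_of_mul_eq [NondegenerateAlgebra B] {f : A →ₙₐ[k] Mult k B}
    (hf : IsNondegenerateHom f) {F G : Mult k B} (h : ∀ a, F * f a = G * f a) : F = G := by
  refine Mult.ext_L ?_
  refine LinearMap.ext_on hf.span_left ?_
  rintro _ ⟨a, b, rfl⟩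
  rw [← Mult.L_mul, ← Mult.L_mul, h]

theorem existsUnique_extension [NondegenerateAlgebra A] [NondegenerateAlgebra B]
    {f : A →ₙₐ[k] Mult k B} (hf : IsNondegenerateHom f) :
    ∃! F : Mult k A →ₐ[k] Mult k B, ∀ a, F (ofElt k A a) = f a := by
  choose F hF using exists_extension_apply hf
  refine ⟨AlgHom.ofLinearMap
    { toFun := F
      map_add' := fun m n => eq_of_mul_eq hf fun a => by simp [add_mul, hF]
      map_smul' := fun r m => eq_of_mul_eq hf fun a => by simp [hF] }
    (eq_of_mul_eq hf fun a => by simp [hF])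
    (fun m n => eq_of_mul_eq hf fun a => by simp [mul_assoc, hF]), ?_, ?_⟩
  · intro a
    exact eq_of_mul_eq hf fun b => by simp [hF]
  · intro G hG
    refine AlgHom.ext fun m => eq_of_mul_eq hf fun a => ?_
    simp only [AlgHom.ofLinearMap_apply, LinearMap.coe_mk, AddHom.coe_mk]
    rw [hF, ← hG, ← hG, ← map_mul, mul_ofElt]

/-- The unique extension of a nondegenerate homomorphism `A → M(B)` to a unital homomorphism
`M(A) → M(B)`. -/
def extend [NondegenerateAlgebra A] [NondegenerateAlgebra B]
    {f : A →ₙₐ[k] Mult k B} (hf : IsNondegenerateHom f) : Mult k A →ₐ[k] Mult k B :=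
  (existsUnique_extension hf).choose

end Extension

section Tensor

variable {k : Type*} [Field k]
variable {A : Type*} [NonUnitalRing A] [Module k A] [IsScalarTower k A A] [SMulCommClass k A A]
variable {B : Type*} [NonUnitalRing B] [Module k B] [IsScalarTower k B B] [SMulCommClass k B B]

theorem tensor_eq_zero (t : A ⊗[k] B)
    (h : ∀ ψ : Module.Dual k B, TensorProduct.rid k A (ψ.lTensor A t) = 0) : t = 0 := by
  let b := Module.Free.chooseBasis k B
  apply (TensorProduct.equivFinsuppOfBasisRight (M := A) b).injective
  rw [map_zero]
  ext i
  rw [TensorProduct.equivFinsuppOfBasisRight_apply, Finsupp.zero_apply]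
  exact h (b.coord i)

theorem tensor_eq_zero' (t : A ⊗[k] B)
    (h : ∀ ψ : Module.Dual k A, TensorProduct.lid k B (ψ.rTensor B t) = 0) : t = 0 := by
  let b := Module.Free.chooseBasis k A
  apply (TensorProduct.equivFinsuppOfBasisLeft (N := B) b).injective
  rw [map_zero]
  ext i
  rw [TensorProduct.equivFinsuppOfBasisLeft_apply, Finsupp.zero_apply]
  exact h (b.coord i)

instance [NondegenerateAlgebra A] [NondegenerateAlgebra B] :
    NondegenerateAlgebra (A ⊗[k] B) where
  eq_zero_of_mul_right t ht := by
    have h1 : ∀ (b : B), (LinearMap.mulRight k b).lTensor A t = 0 := by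
      intro b
      refine tensor_eq_zero _ fun ψ => ?_
      refine NondegenerateAlgebra.eq_zero_of_mul_right _ fun a => ?_
      have h2 : ∀ t : A ⊗[k] B,
          TensorProduct.rid k A (ψ.lTensor A ((LinearMap.mulRight k b).lTensor A t)) * a =
            TensorProduct.rid k A (ψ.lTensor A (t * (a ⊗ₜ b))) := by
        intro t
        induction t with
        | zero => simp
        | add x y hx hy => simp only [map_add, add_mul, hx, hy]
        | tmul x y => simp [smul_mul_assoc, mul_smul_comm]
      rw [h2, ht, map_zero, map_zero]
    refine tensor_eq_zero' _ fun ψ => ?_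
    refine NondegenerateAlgebra.eq_zero_of_mul_right _ fun b => ?_
    have h3 : ∀ t : A ⊗[k] B, TensorProduct.lid k B (ψ.rTensor B t) * b =
        TensorProduct.lid k B (ψ.rTensor B ((LinearMap.mulRight k b).lTensor A t)) := by
      intro t
      induction t with
      | zero => simp
      | add x y hx hy => simp only [map_add, add_mul, hx, hy]
      | tmul x y => simp [smul_mul_assoc, mul_smul_comm]
    rw [h3, h1, map_zero, map_zero]
  eq_zero_of_mul_left t ht := by
    have h1 : ∀ (b : B), (LinearMap.mulLeft k b).lTensor A t = 0 := by
      intro b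
      refine tensor_eq_zero _ fun ψ => ?_
      refine NondegenerateAlgebra.eq_zero_of_mul_left _ fun a => ?_
      have h2 : ∀ t : A ⊗[k] B,
          a * TensorProduct.rid k A (ψ.lTensor A ((LinearMap.mulLeft k b).lTensor A t)) =
            TensorProduct.rid k A (ψ.lTensor A ((a ⊗ₜ b) * t)) := by
        intro t
        induction t with
        | zero => simp
        | add x y hx hy => simp only [map_add, mul_add, hx, hy]
        | tmul x y => simp [smul_mul_assoc, mul_smul_comm]
      rw [h2, ht, map_zero, map_zero]
    refine tensor_eq_zero' _ fun ψ => ?_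
    refine NondegenerateAlgebra.eq_zero_of_mul_left _ fun b => ?_
    have h3 : ∀ t : A ⊗[k] B, b * TensorProduct.lid k B (ψ.rTensor B t) =
        TensorProduct.lid k B (ψ.rTensor B ((LinearMap.mulLeft k b).lTensor A t)) := by
      intro t
      induction t with
      | zero => simp
      | add x y hx hy => simp only [map_add, mul_add, hx, hy]
      | tmul x y => simp [smul_mul_assoc, mul_smul_comm]
    rw [h3, h1, map_zero, map_zero]

/-- The multiplier `m ⊗ n ∈ M(A ⊗ B)` for `m ∈ M(A)` and `n ∈ M(B)`. -/
def Mult.tmul (m : Mult k A) (n : Mult k B) : Mult k (A ⊗[k] B) :=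
  Mult.mk (TensorProduct.map m.L n.L) (TensorProduct.map m.R n.R) (by
    intro x y
    induction x with
    | zero => simp
    | add x x' hx hx' => simp only [map_add, add_mul, hx, hx']
    | tmul a b =>
      induction y with
      | zero => simp
      | add y y' hy hy' => simp only [map_add, mul_add, hy, hy']
      | tmul c d => simp [Mult.compat])

theorem Mult.add_tmul (m m' : Mult k A) (n : Mult k B) :
    (m + m').tmul n = m.tmul n + m'.tmul n :=
  Mult.ext' (TensorProduct.map_add_left _ _ _) (TensorProduct.map_add_left _ _ _)

theorem Mult.tmul_add (m : Mult k A) (n n' : Mult k B) :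
    m.tmul (n + n') = m.tmul n + m.tmul n' :=
  Mult.ext' (TensorProduct.map_add_right _ _ _) (TensorProduct.map_add_right _ _ _)

theorem Mult.smul_tmul (r : k) (m : Mult k A) (n : Mult k B) :
    (r • m).tmul n = r • m.tmul n :=
  Mult.ext' (TensorProduct.map_smul_left _ _ _) (TensorProduct.map_smul_left _ _ _)

theorem Mult.tmul_smul (r : k) (m : Mult k A) (n : Mult k B) :
    m.tmul (r • n) = r • m.tmul n :=
  Mult.ext' (TensorProduct.map_smul_right _ _ _) (TensorProduct.map_smul_right _ _ _)

/-- The map `(m, n) ↦ m ⊗ n` as a bilinear map `M(A) × M(B) → M(A ⊗ B)`. -/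
def Mult.tmulₗ : Mult k A →ₗ[k] Mult k B →ₗ[k] Mult k (A ⊗[k] B) :=
  LinearMap.mk₂ k Mult.tmul Mult.add_tmul Mult.smul_tmul Mult.tmul_add
    (fun r m n => Mult.tmul_smul r m n)

/-- The flip `M(A ⊗ B) → M(B ⊗ A)`. -/
def flip : Mult k (A ⊗[k] B) →ₐ[k] Mult k (B ⊗[k] A) :=
  AlgHom.ofLinearMap
    { toFun := fun m => Mult.mk
        ((TensorProduct.comm k A B).toLinearMap ∘ₗ m.L ∘ₗ (TensorProduct.comm k B A).toLinearMap)
        ((TensorProduct.comm k A B).toLinearMap ∘ₗ m.R ∘ₗ (TensorProduct.comm k B A).toLinearMap)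
        (by
          have hc : ∀ x y : A ⊗[k] B, TensorProduct.comm k A B (x * y) =
              TensorProduct.comm k A B x * TensorProduct.comm k A B y := by
            intro x y
            induction x with
            | zero => simp
            | add x x' hx hx' => simp only [map_add, add_mul, hx, hx']
            | tmul a b =>
              induction y with
              | zero => simp
              | add y y' hy hy' => simp only [map_add, mul_add, hy, hy']
              | tmul c d => simp
          intro x y
          obtain ⟨x, rfl⟩ := (TensorProduct.comm k A B).surjective x
          obtain ⟨y, rfl⟩ := (TensorProduct.comm k A B).surjective y
          simp [← hc, Mult.compat])
      map_add' := fun m n => Mult.ext' (by ext; simp) (by ext; simp)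
      map_smul' := fun r m => Mult.ext' (by ext; simp) (by ext; simp) }
    (Mult.ext' (by ext; simp) (by ext; simp))
    (fun m n => Mult.ext' (by ext; simp) (by ext; simp))

end Tensor

section MultiplierHopf

variable {k : Type*} [Field k]
variable {A : Type*} [NonUnitalRing A] [Module k A] [IsScalarTower k A A] [SMulCommClass k A A]

/-- The subsets `Δ(A)(1 ⊗ A)`, `Δ(A)(A ⊗ 1)`, `(A ⊗ 1)Δ(A)` and `(1 ⊗ A)Δ(A)` of `M(A ⊗ A)` are
contained in `A ⊗ A`. -/
structure HasCovers (Δ : A →ₙₐ[k] Mult k (A ⊗[k] A)) : Prop where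
  mul_one_tmul : ∀ a b : A, InAlg (Δ a * (1 : Mult k A).tmul (ofElt k A b))
  mul_tmul_one : ∀ a b : A, InAlg (Δ a * (ofElt k A b).tmul (1 : Mult k A))
  tmul_one_mul : ∀ a b : A, InAlg ((ofElt k A a).tmul (1 : Mult k A) * Δ b)
  one_tmul_mul : ∀ a b : A, InAlg ((1 : Mult k A).tmul (ofElt k A a) * Δ b)

section Covers

variable [NondegenerateAlgebra A] {Δ : A →ₙₐ[k] Mult k (A ⊗[k] A)} (h : HasCovers Δ)

/-- `T₁ (a ⊗ b) = Δ(a)(1 ⊗ b)`. -/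
def HasCovers.T₁ : A ⊗[k] A →ₗ[k] A ⊗[k] A :=
  descend (TensorProduct.lift (LinearMap.mk₂ k
    (fun a b => Δ a * (1 : Mult k A).tmul (ofElt k A b))
    (by simp [add_mul]) (by simp) (by simp [Mult.tmul_add, mul_add]) (by simp [Mult.tmul_smul])))
    (inAlg_lift _ h.mul_one_tmul)

/-- `T₂ (a ⊗ b) = (a ⊗ 1)Δ(b)`. -/
def HasCovers.T₂ : A ⊗[k] A →ₗ[k] A ⊗[k] A :=
  descend (TensorProduct.lift (LinearMap.mk₂ k
    (fun a b => (ofElt k A a).tmul (1 : Mult k A) * Δ b)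
    (by simp [Mult.add_tmul, add_mul]) (by simp [Mult.smul_tmul]) (by simp [mul_add]) (by simp)))
    (inAlg_lift _ h.tmul_one_mul)

/-- `T₃ (a ⊗ b) = Δ(a)(b ⊗ 1)`. -/
def HasCovers.T₃ : A ⊗[k] A →ₗ[k] A ⊗[k] A :=
  descend (TensorProduct.lift (LinearMap.mk₂ k
    (fun a b => Δ a * (ofElt k A b).tmul (1 : Mult k A))
    (by simp [add_mul]) (by simp) (by simp [Mult.add_tmul, mul_add]) (by simp [Mult.smul_tmul])))
    (inAlg_lift _ h.mul_tmul_one)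

/-- `T₄ (a ⊗ b) = (1 ⊗ a)Δ(b)`. -/
def HasCovers.T₄ : A ⊗[k] A →ₗ[k] A ⊗[k] A :=
  descend (TensorProduct.lift (LinearMap.mk₂ k
    (fun a b => (1 : Mult k A).tmul (ofElt k A a) * Δ b)
    (by simp [Mult.tmul_add, add_mul]) (by simp [Mult.tmul_smul]) (by simp [mul_add]) (by simp)))
    (inAlg_lift _ h.one_tmul_mul)

theorem HasCovers.ofElt_T₁ (a b : A) :
    ofElt k (A ⊗[k] A) (h.T₁ (a ⊗ₜ b)) = Δ a * (1 : Mult k A).tmul (ofElt k A b) := by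
  simp [HasCovers.T₁, ofElt_descend]

theorem HasCovers.ofElt_T₂ (a b : A) :
    ofElt k (A ⊗[k] A) (h.T₂ (a ⊗ₜ b)) = (ofElt k A a).tmul (1 : Mult k A) * Δ b := by
  simp [HasCovers.T₂, ofElt_descend]

theorem HasCovers.ofElt_T₃ (a b : A) :
    ofElt k (A ⊗[k] A) (h.T₃ (a ⊗ₜ b)) = Δ a * (ofElt k A b).tmul (1 : Mult k A) := by
  simp [HasCovers.T₃, ofElt_descend]

theorem HasCovers.ofElt_T₄ (a b : A) :
    ofElt k (A ⊗[k] A) (h.T₄ (a ⊗ₜ b)) = (1 : Mult k A).tmul (ofElt k A a) * Δ b := by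
  simp [HasCovers.T₄, ofElt_descend]

end Covers

variable [NondegenerateAlgebra A]

/-- `(A, Δ)` is a multiplier bialgebra. Coassociativity `(Δ ⊗ ι)Δ = (ι ⊗ Δ)Δ` is the equality of
multipliers of `A ⊗ A ⊗ A`, expressed by multiplying with `a ⊗ 1 ⊗ 1` on the left and with
`1 ⊗ 1 ⊗ c` on the right:
`(a ⊗ 1 ⊗ 1) (Δ ⊗ ι)(Δ(b)(1 ⊗ c)) = (ι ⊗ Δ)((a ⊗ 1)Δ(b)) (1 ⊗ 1 ⊗ c)`. -/
structure IsMultiplierBialgebra (Δ : A →ₙₐ[k] Mult k (A ⊗[k] A)) : Prop extends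
    HasCovers Δ where
  nondegenerate : IsNondegenerateHom Δ
  coassoc : ∀ a b c : A,
    TensorProduct.assoc k A A A
        ((toHasCovers.T₂ ∘ₗ TensorProduct.mk k A A a).rTensor A (toHasCovers.T₁ (b ⊗ₜ c))) =
      (toHasCovers.T₁ ∘ₗ (TensorProduct.mk k A A).flip c).lTensor A (toHasCovers.T₂ (a ⊗ₜ b))

/-- `(A, Δ)` is a multiplier Hopf algebra: the canonical maps `T₁` and `T₂` are bijective. -/
structure IsMultiplierHopf (Δ : A →ₙₐ[k] Mult k (A ⊗[k] A)) : Prop extends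
    IsMultiplierBialgebra Δ where
  bijective_T₁ : Function.Bijective toHasCovers.T₁
  bijective_T₂ : Function.Bijective toHasCovers.T₂

/-- `(A, Δ)` is a regular multiplier Hopf algebra: `(A, Δ)` and `(A, σΔ)` are multiplier Hopf
algebras, with `σ` the flip. -/
structure IsRegularMultiplierHopf (Δ : A →ₙₐ[k] Mult k (A ⊗[k] A)) : Prop extends
    IsMultiplierHopf Δ where
  cop : IsMultiplierHopf ((flip : Mult k (A ⊗[k] A) →ₐ[k] _).toNonUnitalAlgHom.comp Δ)

/-- `ε` satisfies `(ε ⊗ ι)(Δ(a)(1 ⊗ b)) = ab` and `(ι ⊗ ε)((a ⊗ 1)Δ(b)) = ab`. -/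
structure IsCounit {Δ : A →ₙₐ[k] Mult k (A ⊗[k] A)} (h : HasCovers Δ) (ε : A →ₗ[k] k) :
    Prop where
  left : ∀ a b : A, TensorProduct.lid k A (ε.rTensor A (h.T₁ (a ⊗ₜ b))) = a * b
  right : ∀ a b : A, TensorProduct.rid k A (ε.lTensor A (h.T₂ (a ⊗ₜ b))) = a * b

theorem exists_counit_linear {Δ : A →ₙₐ[k] Mult k (A ⊗[k] A)} (h : IsMultiplierHopf Δ) :
    ∃ ε : A →ₗ[k] k, IsCounit h.toHasCovers ε := by
  rcases subsingleton_or_nontrivial A with hs | hn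
  · exact ⟨0, fun a b => Subsingleton.elim _ _, fun a b => Subsingleton.elim _ _⟩
  obtain ⟨x₀, hx₀⟩ := exists_ne (0 : A)
  obtain ⟨ω, hω⟩ := Module.Projective.exists_dual_ne_zero k hx₀
  let T := h.toHasCovers.T₁
  let S := h.toHasCovers.T₂
  let eT := LinearEquiv.ofBijective T h.bijective_T₁
  let eS := LinearEquiv.ofBijective S h.bijective_T₂
  let m : A ⊗[k] A →ₗ[k] A := LinearMap.mul' k A
  let P : A ⊗[k] A →ₗ[k] A := m ∘ₗ eT.symm.toLinearMap
  let Q : A ⊗[k] A →ₗ[k] A := m ∘ₗ eS.symm.toLinearMap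
  have hP : ∀ u, P (T u) = m u := fun u => congrArg m (eT.symm_apply_apply u)
  have hQ : ∀ u, Q (S u) = m u := fun u => congrArg m (eS.symm_apply_apply u)
  have h1 : ∀ a b c : A, P.lTensor A (TensorProduct.assoc k A A A (S (a ⊗ₜ b) ⊗ₜ c)) =
      (a * b) ⊗ₜ c := by
    intro a b c
    have h2 : ∀ u : A ⊗[k] A, P.lTensor A
        (TensorProduct.assoc k A A A ((S ∘ₗ TensorProduct.mk k A A a).rTensor A (T u))) =
          (LinearMap.mulLeft k a).rTensor A (T u) := by
      intro u
      induction u with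
      | zero => simp
      | add u v hu hv => simp only [map_add, hu, hv]
      | tmul b c =>
        have h3 := h.coassoc a b c
        change TensorProduct.assoc k A A A
          ((S ∘ₗ TensorProduct.mk k A A a).rTensor A (T (b ⊗ₜ c))) =
            (T ∘ₗ (TensorProduct.mk k A A).flip c).lTensor A (S (a ⊗ₜ b)) at h3
        rw [h3, ← LinearMap.comp_apply, ← LinearMap.lTensor_comp]
        have h4 : P ∘ₗ T ∘ₗ (TensorProduct.mk k A A).flip c = LinearMap.mulRight k c :=
          LinearMap.ext fun p => by simp [hP, m]
        rw [h4]
        apply ofElt_injective (k := k)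
        have h5 : (LinearMap.mulRight k c).lTensor A (S (a ⊗ₜ b)) =
            ((1 : Mult k A).tmul (ofElt k A c)).R (S (a ⊗ₜ b)) := rfl
        have h6 : (LinearMap.mulLeft k a).rTensor A (T (b ⊗ₜ c)) =
            ((ofElt k A a).tmul (1 : Mult k A)).L (T (b ⊗ₜ c)) := rfl
        rw [h5, h6, ← ofElt_mul, ← mul_ofElt, h.toHasCovers.ofElt_T₁, h.toHasCovers.ofElt_T₂,
          mul_assoc]
    obtain ⟨u, hu⟩ := h.bijective_T₁.2 (b ⊗ₜ c)
    have h7 := h2 u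
    change T u = b ⊗ₜ c at hu
    rw [hu] at h7
    simpa using h7
  have key : ∀ (c : A) (u : A ⊗[k] A),
      P.lTensor A (TensorProduct.assoc k A A A (u ⊗ₜ c)) = Q u ⊗ₜ c := by
    intro c u
    obtain ⟨v, rfl⟩ := h.bijective_T₂.2 u
    change P.lTensor A (TensorProduct.assoc k A A A (S v ⊗ₜ c)) = Q (S v) ⊗ₜ c
    rw [hQ]
    induction v with
    | zero => simp
    | add v w hv hw => simp only [map_add, TensorProduct.add_tmul, hv, hw]
    | tmul a b => rw [h1]; simp [m]
  have key' : ∀ x y c : A, x ⊗ₜ[k] P (y ⊗ₜ c) = Q (x ⊗ₜ y) ⊗ₜ[k] c := by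
    intro x y c
    simpa using key c (x ⊗ₜ y)
  let ε : A →ₗ[k] k := (ω x₀)⁻¹ • ω ∘ₗ Q ∘ₗ TensorProduct.mk k A A x₀
  have hεP : ∀ y c, P (y ⊗ₜ c) = ε y • c := by
    intro y c
    have h8 := congrArg (fun t => TensorProduct.lid k A (ω.rTensor A t)) (key' x₀ y c)
    simp only [LinearMap.rTensor_tmul, TensorProduct.lid_tmul] at h8
    simp only [ε, LinearMap.smul_apply, LinearMap.comp_apply, TensorProduct.mk_apply, smul_eq_mul,
      mul_smul, ← h8]
    rw [inv_smul_smul₀ hω]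
  have hεQ : ∀ x y, Q (x ⊗ₜ y) = ε y • x := by
    intro x y
    have h8 := congrArg (fun t => TensorProduct.rid k A (ω.lTensor A t)) (key' x y x₀)
    simp only [LinearMap.lTensor_tmul, TensorProduct.rid_tmul, hεP, map_smul, smul_eq_mul] at h8
    have h9 := congrArg (fun t => (ω x₀)⁻¹ • t) h8
    simp only [inv_smul_smul₀ hω] at h9
    rw [← h9, smul_smul]
    congr 1
    field_simp
  have hL : TensorProduct.lid k A ∘ₗ ε.rTensor A = P :=
    TensorProduct.ext' fun y c => by simp [hεP]
  have hR : TensorProduct.rid k A ∘ₗ ε.lTensor A = Q :=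
    TensorProduct.ext' fun x y => by simp [hεQ]
  refine ⟨ε, fun a b => ?_, fun a b => ?_⟩
  · exact (LinearMap.congr_fun hL (T (a ⊗ₜ b))).trans ((hP _).trans (by simp [m]))
  · exact (LinearMap.congr_fun hR (S (a ⊗ₜ b))).trans ((hQ _).trans (by simp [m]))

theorem IsCounit.map_mul {Δ : A →ₙₐ[k] Mult k (A ⊗[k] A)} (h : IsMultiplierHopf Δ) {ε : A →ₗ[k] k}
    (hε : IsCounit h.toHasCovers ε) (q s : A) : ε (q * s) = ε q * ε s := by
  rcases subsingleton_or_nontrivial A with hs | hn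
  · rw [Subsingleton.elim (q * s) 0, Subsingleton.elim q 0]; simp
  obtain ⟨r, hr⟩ := exists_ne (0 : A)
  -- `(ι ⊗ ε)(u Δ(c)) = (ι ⊗ ε)(u) c`
  have h1 : ∀ (c : A) (u : A ⊗[k] A), TensorProduct.rid k A (ε.lTensor A ((Δ c).R u)) =
      TensorProduct.rid k A (ε.lTensor A u) * c := by
    intro c u
    obtain ⟨v, rfl⟩ := h.bijective_T₂.2 u
    induction v with
    | zero => simp
    | add v w hv hw => simp only [_root_.map_add, add_mul, hv, hw]
    | tmul a b =>
      have h2 : (Δ c).R (h.toHasCovers.T₂ (a ⊗ₜ b)) = h.toHasCovers.T₂ (a ⊗ₜ (b * c)) := by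
        apply ofElt_injective (k := k)
        rw [← ofElt_mul, h.toHasCovers.ofElt_T₂, h.toHasCovers.ofElt_T₂, _root_.map_mul, mul_assoc]
      rw [h2, hε.right, hε.right, mul_assoc]
  -- `(ι ⊗ ε)((1 ⊗ q) u) = ε(q) (ι ⊗ ε)(u)`
  have h3 : ∀ u : A ⊗[k] A,
      TensorProduct.rid k A (ε.lTensor A ((LinearMap.mulLeft k q).lTensor A u)) =
        ε q • TensorProduct.rid k A (ε.lTensor A u) := by
    intro u
    obtain ⟨v, rfl⟩ := h.bijective_T₂.2 u
    induction v with
    | zero => simp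
    | add v w hv hw => simp only [_root_.map_add, smul_add, hv, hw]
    | tmul p c =>
      have h4 : (LinearMap.mulLeft k q).lTensor A (h.toHasCovers.T₂ (p ⊗ₜ c)) =
          (Δ c).R (p ⊗ₜ q) := by
        have h5 : (LinearMap.mulLeft k q).lTensor A (h.toHasCovers.T₂ (p ⊗ₜ c)) =
            ((1 : Mult k A).tmul (ofElt k A q)).L (h.toHasCovers.T₂ (p ⊗ₜ c)) := rfl
        apply ofElt_injective (k := k)
        rw [h5, ← mul_ofElt, ← ofElt_mul, h.toHasCovers.ofElt_T₂, ← mul_assoc]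
        congr 1
        exact Mult.ext_L (TensorProduct.ext' fun x y => by simp [Mult.tmul])
      rw [h4, h1, hε.right]
      simp [smul_mul_assoc]
  have h6 := h3 (r ⊗ₜ s)
  simp only [LinearMap.lTensor_tmul, TensorProduct.rid_tmul, LinearMap.mulLeft_apply,
    smul_smul] at h6
  exact smul_left_injective k hr h6

theorem exists_counit {Δ : A →ₙₐ[k] Mult k (A ⊗[k] A)} (h : IsMultiplierHopf Δ) :
    ∃ ε : A →ₙₐ[k] k, IsCounit h.toHasCovers (ε : A →ₗ[k] k) := by
  obtain ⟨ε, hε⟩ := exists_counit_linear h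
  exact ⟨{ ε with
    map_zero' := ε.map_zero
    map_mul' := hε.map_mul h }, hε⟩

/-- The counit of a multiplier Hopf algebra, the unique linear map with
`(ε ⊗ ι)(Δ(a)(1 ⊗ b)) = ab` and `(ι ⊗ ε)((a ⊗ 1)Δ(b)) = ab`; it is multiplicative. -/
def counit {Δ : A →ₙₐ[k] Mult k (A ⊗[k] A)} (h : IsMultiplierHopf Δ) : A →ₙₐ[k] k :=
  (exists_counit h).choose

theorem isCounit_counit {Δ : A →ₙₐ[k] Mult k (A ⊗[k] A)} (h : IsMultiplierHopf Δ) :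
    IsCounit h.toHasCovers (counit h : A →ₗ[k] k) :=
  (exists_counit h).choose_spec

theorem exists_counit_eq_one [Nontrivial A] {Δ : A →ₙₐ[k] Mult k (A ⊗[k] A)}
    (h : IsMultiplierHopf Δ) : ∃ a : A, counit h a = 1 := by
  by_contra! hne
  have h0 : (counit h : A →ₗ[k] k) = 0 := by
    ext a
    by_contra ha
    exact hne ((counit h a)⁻¹ • a) (by
      rw [map_smul, smul_eq_mul]; exact inv_mul_cancel₀ ha)
  obtain ⟨a, ha⟩ := exists_ne (0 : A)
  refine ha (NondegenerateAlgebra.eq_zero_of_mul_right a fun b => ?_)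
  rw [← (isCounit_counit h).left, h0]
  simp

theorem span_mul_eq_top {Δ : A →ₙₐ[k] Mult k (A ⊗[k] A)} (h : IsMultiplierHopf Δ) :
    Submodule.span k {x : A | ∃ a b : A, x = a * b} = ⊤ := by
  rcases subsingleton_or_nontrivial A with hs | hn
  · exact Subsingleton.elim _ _
  obtain ⟨a, ha⟩ := exists_counit_eq_one h
  rw [eq_top_iff]
  rintro b -
  obtain ⟨u, hu⟩ := h.bijective_T₁.2 (a ⊗ₜ b)
  have hb : b = TensorProduct.lid k A ((counit h : A →ₗ[k] k).rTensor A (a ⊗ₜ b)) := by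
    simp [ha]
  rw [hb, ← hu]
  clear hb hu
  induction u with
  | zero => simp
  | add u v hu hv => simp only [map_add]; exact Submodule.add_mem _ hu hv
  | tmul p q => rw [(isCounit_counit h).left]; exact Submodule.subset_span ⟨p, q, rfl⟩

instance : NondegenerateAlgebra k where
  eq_zero_of_mul_right a h := by simpa using h 1
  eq_zero_of_mul_left a h := by simpa using h 1

/-- The counit as a homomorphism `A → M(k)`. -/
def counitHom {Δ : A →ₙₐ[k] Mult k (A ⊗[k] A)} (h : IsMultiplierHopf Δ) : A →ₙₐ[k] Mult k k :=
  (ofElt k k).comp (counit h)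

theorem isNondegenerateHom_counitHom [Nontrivial A] {Δ : A →ₙₐ[k] Mult k (A ⊗[k] A)}
    (h : IsMultiplierHopf Δ) : IsNondegenerateHom (counitHom h) := by
  obtain ⟨a, ha⟩ := exists_counit_eq_one h
  constructor
  · rw [eq_top_iff]
    exact fun x _ => Submodule.subset_span ⟨a, x, by simp [counitHom, ha]⟩
  · rw [eq_top_iff]
    exact fun x _ => Submodule.subset_span ⟨a, x, by simp [counitHom, ha]⟩

/-- The value `ε(h)` of the counit on `h ∈ M(A)`, through the extension `M(A) → M(k) = k`. -/
def counitMult [Nontrivial A] {Δ : A →ₙₐ[k] Mult k (A ⊗[k] A)} (h : IsMultiplierHopf Δ)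
    (x : Mult k A) : k :=
  (extend (isNondegenerateHom_counitHom h) x).L 1

/-- The extension `Δ : M(A) → M(A ⊗ A)` of the comultiplication. -/
def comulMult {Δ : A →ₙₐ[k] Mult k (A ⊗[k] A)} (h : IsMultiplierHopf Δ) :
    Mult k A →ₐ[k] Mult k (A ⊗[k] A) :=
  extend h.nondegenerate

end MultiplierHopf

section Completion

variable {k : Type*} [Field k]
variable {Y : Type*} [NonUnitalRing Y] [Module k Y] [IsScalarTower k Y Y] [SMulCommClass k Y Y]
variable {X : Type*} [NonUnitalRing X] [Module k X] [IsScalarTower k X X] [SMulCommClass k X X]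

/-- The inclusion `M₀(Y ⊗ X) ⊆ M(Y ⊗ X)` of the completion of the `Y`-bimodule `Y ⊗ X` (with `Y`
acting on the left tensor factor): the multiplier `z` with `z (y ⊗ 1) = l y` and
`(y ⊗ 1) z = r y`, that is `z (y ⊗ x) = l y (1 ⊗ x)` and `(y ⊗ x) z = (1 ⊗ x) r y`. -/
def ofCompletionLeft (l r : Y →ₗ[k] Y ⊗[k] X)
    (hlr : ∀ a b : Y, ((ofElt k Y a).tmul (1 : Mult k X)).L (l b) =
      ((ofElt k Y b).tmul (1 : Mult k X)).R (r a)) : Mult k (Y ⊗[k] X) :=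
  Mult.mk
    (TensorProduct.lift (LinearMap.mk₂ k
      (fun (y : Y) (x : X) => ((1 : Mult k Y).tmul (ofElt k X x)).R (l y))
      (by simp) (by simp) (by simp [Mult.tmul_add]) (by simp [Mult.tmul_smul])))
    (TensorProduct.lift (LinearMap.mk₂ k
      (fun (y : Y) (x : X) => ((1 : Mult k Y).tmul (ofElt k X x)).L (r y))
      (by simp) (by simp) (by simp [Mult.tmul_add]) (by simp [Mult.tmul_smul])))
    (by
      have h1 : ∀ (a : Y) (x : X) (u : Y ⊗[k] X), (a ⊗ₜ[k] x) * u =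
          ((1 : Mult k Y).tmul (ofElt k X x)).L (((ofElt k Y a).tmul (1 : Mult k X)).L u) := by
        intro a x u
        induction u with
        | zero => simp
        | add u v hu hv => simp only [mul_add, map_add, hu, hv]
        | tmul c d => simp [Mult.tmul]
      have h2 : ∀ (a : Y) (x : X) (u : Y ⊗[k] X), u * (a ⊗ₜ[k] x) =
          ((1 : Mult k Y).tmul (ofElt k X x)).R (((ofElt k Y a).tmul (1 : Mult k X)).R u) := by
        intro a x u
        induction u with
        | zero => simp
        | add u v hu hv => simp only [add_mul, map_add, hu, hv]
        | tmul c d => simp [Mult.tmul]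
      have h3 : ∀ (x x' : X) (u : Y ⊗[k] X),
          ((1 : Mult k Y).tmul (ofElt k X x)).L (((1 : Mult k Y).tmul (ofElt k X x')).R u) =
          ((1 : Mult k Y).tmul (ofElt k X x')).R (((1 : Mult k Y).tmul (ofElt k X x)).L u) := by
        intro x x' u
        induction u with
        | zero => simp
        | add u v hu hv => simp only [map_add, hu, hv]
        | tmul c d => simp [Mult.tmul, mul_assoc]
      have h4 : ∀ (a : Y) (x : X) (u : Y ⊗[k] X),
          ((ofElt k Y a).tmul (1 : Mult k X)).L (((1 : Mult k Y).tmul (ofElt k X x)).R u) =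
          ((1 : Mult k Y).tmul (ofElt k X x)).R (((ofElt k Y a).tmul (1 : Mult k X)).L u) := by
        intro a x u
        induction u with
        | zero => simp
        | add u v hu hv => simp only [map_add, hu, hv]
        | tmul c d => simp [Mult.tmul]
      have h5 : ∀ (a : Y) (x : X) (u : Y ⊗[k] X),
          ((ofElt k Y a).tmul (1 : Mult k X)).R (((1 : Mult k Y).tmul (ofElt k X x)).L u) =
          ((1 : Mult k Y).tmul (ofElt k X x)).L (((ofElt k Y a).tmul (1 : Mult k X)).R u) := by
        intro a x u
        induction u with
        | zero => simp
        | add u v hu hv => simp only [map_add, hu, hv]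
        | tmul c d => simp [Mult.tmul]
      intro u v
      induction u with
      | zero => simp
      | add u u' hu hu' => simp only [map_add, add_mul, hu, hu']
      | tmul a x =>
        induction v with
        | zero => simp
        | add v v' hv hv' => simp only [map_add, mul_add, hv, hv']
        | tmul b x' =>
          simp only [TensorProduct.lift.tmul, LinearMap.mk₂_apply]
          rw [h1, h2, h4, h5, hlr, h3])

/-- The inclusion `M₀(X ⊗ Y) ⊆ M(X ⊗ Y)` of the completion of the `Y`-bimodule `X ⊗ Y` (with `Y`
acting on the right tensor factor): the multiplier `z` with `z (1 ⊗ y) = l y` and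
`(1 ⊗ y) z = r y`. -/
def ofCompletionRight (l r : Y →ₗ[k] X ⊗[k] Y)
    (hlr : ∀ a b : Y, ((1 : Mult k X).tmul (ofElt k Y a)).L (l b) =
      ((1 : Mult k X).tmul (ofElt k Y b)).R (r a)) : Mult k (X ⊗[k] Y) :=
  flip (ofCompletionLeft ((TensorProduct.comm k X Y).toLinearMap ∘ₗ l)
    ((TensorProduct.comm k X Y).toLinearMap ∘ₗ r) (by
      have h1 : ∀ (m : Mult k Y) (n : Mult k X) (u : X ⊗[k] Y),
          (m.tmul n).L (TensorProduct.comm k X Y u) =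
            TensorProduct.comm k X Y ((n.tmul m).L u) := by
        intro m n u
        induction u with
        | zero => simp
        | add u v hu hv => simp only [map_add, hu, hv]
        | tmul c d => simp [Mult.tmul]
      have h2 : ∀ (m : Mult k Y) (n : Mult k X) (u : X ⊗[k] Y),
          (m.tmul n).R (TensorProduct.comm k X Y u) =
            TensorProduct.comm k X Y ((n.tmul m).R u) := by
        intro m n u
        induction u with
        | zero => simp
        | add u v hu hv => simp only [map_add, hu, hv]
        | tmul c d => simp [Mult.tmul]
      intro a b
      simp only [LinearMap.comp_apply, LinearEquiv.coe_coe, h1, h2, hlr]))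

variable [NondegenerateAlgebra Y] {Δ : Y →ₙₐ[k] Mult k (Y ⊗[k] Y)} (h : HasCovers Δ)

/-- The multiplier `(ι ⊗ g)(Δ(y)) ∈ M₀(Y ⊗ X) ⊆ M(Y ⊗ X)` for a linear map `g : Y → X`:
its products with `y' ⊗ 1` are `(ι ⊗ g)(Δ(y)(y' ⊗ 1))` and `(ι ⊗ g)((y' ⊗ 1)Δ(y))`. -/
def HasCovers.idTensor (g : Y →ₗ[k] X) (y : Y) : Mult k (Y ⊗[k] X) :=
  ofCompletionLeft (g.lTensor Y ∘ₗ h.T₃ ∘ₗ TensorProduct.mk k Y Y y)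
    (g.lTensor Y ∘ₗ h.T₂ ∘ₗ (TensorProduct.mk k Y Y).flip y) (by
      have h1 : ∀ (m : Mult k Y) (u : Y ⊗[k] Y), (m.tmul (1 : Mult k X)).L (g.lTensor Y u) =
          g.lTensor Y ((m.tmul (1 : Mult k Y)).L u) := by
        intro m u
        induction u with
        | zero => simp
        | add u v hu hv => simp only [map_add, hu, hv]
        | tmul c d => simp [Mult.tmul]
      have h2 : ∀ (m : Mult k Y) (u : Y ⊗[k] Y), (m.tmul (1 : Mult k X)).R (g.lTensor Y u) =
          g.lTensor Y ((m.tmul (1 : Mult k Y)).R u) := by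
        intro m u
        induction u with
        | zero => simp
        | add u v hu hv => simp only [map_add, hu, hv]
        | tmul c d => simp [Mult.tmul]
      intro a b
      simp only [LinearMap.comp_apply, h1, h2]
      congr 1
      apply ofElt_injective (k := k)
      simp only [TensorProduct.mk_apply, LinearMap.flip_apply]
      rw [← mul_ofElt, ← ofElt_mul, h.ofElt_T₃, h.ofElt_T₂, mul_assoc])

/-- The multiplier `(g ⊗ ι)(Δ(y)) ∈ M₀(X ⊗ Y) ⊆ M(X ⊗ Y)` for a linear map `g : Y → X`:
its products with `1 ⊗ y'` are `(g ⊗ ι)(Δ(y)(1 ⊗ y'))` and `(g ⊗ ι)((1 ⊗ y')Δ(y))`. -/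
def HasCovers.tensorId (g : Y →ₗ[k] X) (y : Y) : Mult k (X ⊗[k] Y) :=
  ofCompletionRight (g.rTensor Y ∘ₗ h.T₁ ∘ₗ TensorProduct.mk k Y Y y)
    (g.rTensor Y ∘ₗ h.T₄ ∘ₗ (TensorProduct.mk k Y Y).flip y) (by
      have h1 : ∀ (m : Mult k Y) (u : Y ⊗[k] Y), ((1 : Mult k X).tmul m).L (g.rTensor Y u) =
          g.rTensor Y (((1 : Mult k Y).tmul m).L u) := by
        intro m u
        induction u with
        | zero => simp
        | add u v hu hv => simp only [map_add, hu, hv]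
        | tmul c d => simp [Mult.tmul]
      have h2 : ∀ (m : Mult k Y) (u : Y ⊗[k] Y), ((1 : Mult k X).tmul m).R (g.rTensor Y u) =
          g.rTensor Y (((1 : Mult k Y).tmul m).R u) := by
        intro m u
        induction u with
        | zero => simp
        | add u v hu hv => simp only [map_add, hu, hv]
        | tmul c d => simp [Mult.tmul]
      intro a b
      simp only [LinearMap.comp_apply, h1, h2]
      congr 1
      apply ofElt_injective (k := k)
      simp only [TensorProduct.mk_apply, LinearMap.flip_apply]
      rw [← mul_ofElt, ← ofElt_mul, h.ofElt_T₁, h.ofElt_T₄, mul_assoc])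

end Completion

section Coaction

variable {k : Type*} [Field k]
variable {A : Type*} [NonUnitalRing A] [Module k A] [IsScalarTower k A A] [SMulCommClass k A A]
variable {Y : Type*} [NonUnitalRing Y] [Module k Y] [IsScalarTower k Y Y] [SMulCommClass k Y Y]

/-- The map `ι ⊗ Δ : A ⊗ Y → M(A ⊗ Y ⊗ Y)`, `a ⊗ y ↦ a ⊗ Δ(y)`. -/
def idTensorComul (Δ : Y →ₙₐ[k] Mult k (Y ⊗[k] Y)) :
    A ⊗[k] Y →ₗ[k] Mult k (A ⊗[k] (Y ⊗[k] Y)) :=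
  TensorProduct.lift (LinearMap.mk₂ k
    (fun (a : A) (y : Y) => (ofElt k A a).tmul (Δ y))
    (by simp [Mult.add_tmul]) (by simp [Mult.smul_tmul])
    (by simp [Mult.tmul_add]) (by simp [Mult.tmul_smul]))

variable [NondegenerateAlgebra A] [NondegenerateAlgebra Y]

/-- The map `T : Y ⊗ A → A ⊗ Y`, `T (y ⊗ a) = ρ(y)(a ⊗ 1)`. -/
def coactT (ρ : Y →ₗ[k] Mult k (A ⊗[k] Y))
    (hρ : ∀ (y : Y) (a : A), InAlg (ρ y * (ofElt k A a).tmul (1 : Mult k Y))) :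
    Y ⊗[k] A →ₗ[k] A ⊗[k] Y :=
  descend (TensorProduct.lift (LinearMap.mk₂ k
    (fun (y : Y) (a : A) => ρ y * (ofElt k A a).tmul (1 : Mult k Y))
    (by simp [add_mul]) (by simp) (by simp [Mult.add_tmul, mul_add]) (by simp [Mult.smul_tmul])))
    (inAlg_lift _ hρ)

/-- The map `T' : A ⊗ Y → A ⊗ Y`, `T' (a ⊗ y) = (a ⊗ 1)ρ(y)`. -/
def coactT' (ρ : Y →ₗ[k] Mult k (A ⊗[k] Y))
    (hρ : ∀ (a : A) (y : Y), InAlg ((ofElt k A a).tmul (1 : Mult k Y) * ρ y)) :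
    A ⊗[k] Y →ₗ[k] A ⊗[k] Y :=
  descend (TensorProduct.lift (LinearMap.mk₂ k
    (fun (a : A) (y : Y) => (ofElt k A a).tmul (1 : Mult k Y) * ρ y)
    (by simp [Mult.add_tmul, add_mul]) (by simp [Mult.smul_tmul]) (by simp [mul_add]) (by simp)))
    (inAlg_lift _ hρ)

variable {ΔA : A →ₙₐ[k] Mult k (A ⊗[k] A)} {ΔY : Y →ₙₐ[k] Mult k (Y ⊗[k] Y)}

/-- The homomorphism `ε ⊗ ι : A ⊗ Y → Y ⊆ M(Y)`. -/
def counitTensorHom (hA : IsMultiplierHopf ΔA) : A ⊗[k] Y →ₙₐ[k] Mult k Y :=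
  (ofElt k Y).comp
    { TensorProduct.lid k Y ∘ₗ (counit hA : A →ₗ[k] k).rTensor Y with
      map_zero' := by simp
      map_mul' := by
        intro u v
        induction u with
        | zero => simp
        | add u u' hu hu' =>
          simp only [AddHom.toFun_eq_coe, LinearMap.coe_toAddHom,
            LinearMap.map_add, add_mul] at hu hu' ⊢
          rw [hu, hu']
        | tmul a y =>
          induction v with
          | zero => simp
          | add v v' hv hv' =>
            simp only [AddHom.toFun_eq_coe, LinearMap.coe_toAddHom,
              LinearMap.map_add, mul_add] at hv hv' ⊢
            rw [hv, hv']
          | tmul b y' => simp [smul_mul_smul_comm] }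

theorem isNondegenerateHom_counitTensorHom [Nontrivial A] (hA : IsMultiplierHopf ΔA)
    (hY : IsMultiplierHopf ΔY) :
    IsNondegenerateHom (counitTensorHom hA : A ⊗[k] Y →ₙₐ[k] Mult k Y) := by
  obtain ⟨a, ha⟩ := exists_counit_eq_one hA
  have h1 : ∀ y : Y, (counitTensorHom hA : A ⊗[k] Y →ₙₐ[k] Mult k Y) (a ⊗ₜ y) = ofElt k Y y := by
    intro y
    have : TensorProduct.lid k Y ((counit hA : A →ₗ[k] k).rTensor Y (a ⊗ₜ y)) = y := by
      simp [ha]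
    exact congrArg (ofElt k Y) this
  constructor
  · rw [eq_top_iff, ← span_mul_eq_top hY]
    refine Submodule.span_mono ?_
    rintro _ ⟨y, y', rfl⟩
    exact ⟨a ⊗ₜ y, y', by rw [h1, L_ofElt]⟩
  · rw [eq_top_iff, ← span_mul_eq_top hY]
    refine Submodule.span_mono ?_
    rintro _ ⟨y, y', rfl⟩
    exact ⟨a ⊗ₜ y', y, by rw [h1, R_ofElt]⟩

/-- The map `ι ⊗ ε : A ⊗ Y → A`. -/
def idTensorCounit (A : Type*) [NonUnitalRing A] [Module k A] (hY : IsMultiplierHopf ΔY) :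
    A ⊗[k] Y →ₗ[k] A :=
  TensorProduct.rid k A ∘ₗ (counit hY : Y →ₗ[k] k).lTensor A

variable [Nontrivial A]

/-- `Y` is a (left) partial `A`-comodule coalgebra via `ρ`. With `T (y ⊗ a) = ρ(y)(a ⊗ 1)`, which
has to lie in `A ⊗ Y`, the conditions are

* `(ε ⊗ ι)ρ(y) = y`;
* `(ι ⊗ T)(Δ(y) ⊗ a) (1 ⊗ 1 ⊗ y')` and `(1 ⊗ 1 ⊗ y') (ι ⊗ T)(Δ(y) ⊗ a)` lie in `Y ⊗ A ⊗ Y`;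
* `(ι ⊗ Δ)T = (T ⊗ ι)(ι ⊗ T)(Δ ⊗ ι)`: an equality of multipliers, stated for their products with
  `1 ⊗ 1 ⊗ y'` on either side;
* `(ι ⊗ T)(T ⊗ ι)(ι ⊗ Δ) = ((ι ⊗ ε)T ⊗ ι ⊗ ι)(ι ⊗ (Δ ⊗ ι)T)(Δ ⊗ ι)`: an equality of multipliers,
  stated for their products with `1 ⊗ a' ⊗ y'` on the right.

The element `t` is the product of `(ι ⊗ T)(Δ(y) ⊗ a)` with `1 ⊗ 1 ⊗ y'`, an element of
`Y ⊗ A ⊗ Y` by the second condition. -/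
structure IsPartialComoduleCoalgebra (hA : IsMultiplierHopf ΔA) (hY : IsMultiplierHopf ΔY)
    (ρ : Y →ₗ[k] Mult k (A ⊗[k] Y)) : Prop where
  cover : ∀ (y : Y) (a : A), InAlg (ρ y * (ofElt k A a).tmul (1 : Mult k Y))
  counit_coact : ∀ y : Y,
    extend (isNondegenerateHom_counitTensorHom hA hY) (ρ y) = ofElt k Y y
  mem_right : ∀ (y y' : Y) (a : A),
    InAlg (hY.idTensor (coactT ρ cover ∘ₗ (TensorProduct.mk k Y A).flip a) y *
      (1 : Mult k Y).tmul ((1 : Mult k A).tmul (ofElt k Y y')))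
  mem_left : ∀ (y y' : Y) (a : A),
    InAlg ((1 : Mult k Y).tmul ((1 : Mult k A).tmul (ofElt k Y y')) *
      hY.idTensor (coactT ρ cover ∘ₗ (TensorProduct.mk k Y A).flip a) y)
  comul_right : ∀ (y y' : Y) (a : A) (t : Y ⊗[k] (A ⊗[k] Y)),
    ofElt k _ t = hY.idTensor (coactT ρ cover ∘ₗ (TensorProduct.mk k Y A).flip a) y *
      (1 : Mult k Y).tmul ((1 : Mult k A).tmul (ofElt k Y y')) →
    idTensorComul ΔY (coactT ρ cover (y ⊗ₜ a)) *
        (1 : Mult k A).tmul ((1 : Mult k Y).tmul (ofElt k Y y')) =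
      ofElt k _ (TensorProduct.assoc k A Y Y
        ((coactT ρ cover).rTensor Y ((TensorProduct.assoc k Y A Y).symm t)))
  comul_left : ∀ (y y' : Y) (a : A) (t : Y ⊗[k] (A ⊗[k] Y)),
    ofElt k _ t = (1 : Mult k Y).tmul ((1 : Mult k A).tmul (ofElt k Y y')) *
      hY.idTensor (coactT ρ cover ∘ₗ (TensorProduct.mk k Y A).flip a) y →
    (1 : Mult k A).tmul ((1 : Mult k Y).tmul (ofElt k Y y')) *
        idTensorComul ΔY (coactT ρ cover (y ⊗ₜ a)) =
      ofElt k _ (TensorProduct.assoc k A Y Y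
        ((coactT ρ cover).rTensor Y ((TensorProduct.assoc k Y A Y).symm t)))
  coassoc : ∀ (y y' : Y) (a a' : A) (t : Y ⊗[k] (A ⊗[k] Y)),
    ofElt k _ t = hY.idTensor (coactT ρ cover ∘ₗ (TensorProduct.mk k Y A).flip a) y *
      (1 : Mult k Y).tmul ((1 : Mult k A).tmul (ofElt k Y y')) →
    -- `(ι ⊗ T)((T ⊗ ι)(y ⊗ Δ(a)(1 ⊗ a'))) (1 ⊗ 1 ⊗ y')`
    ((1 : Mult k A).tmul ((1 : Mult k A).tmul (ofElt k Y y'))).R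
        ((coactT ρ cover).lTensor A (TensorProduct.assoc k A Y A
          ((coactT ρ cover).rTensor A ((TensorProduct.assoc k Y A A).symm
            (y ⊗ₜ hA.T₁ (a ⊗ₜ a')))))) =
      -- `((ι ⊗ ε)T ⊗ ι ⊗ ι)(ι ⊗ Δ( )(1 ⊗ a') ⊗ ι)(t)`
      (idTensorCounit A hY ∘ₗ coactT ρ cover).rTensor (A ⊗[k] Y)
        ((TensorProduct.assoc k Y A (A ⊗[k] Y)).symm
          ((TensorProduct.assoc k A A Y).toLinearMap.lTensor Y
            (((hA.T₁ ∘ₗ (TensorProduct.mk k A A).flip a').rTensor Y).lTensor Y t)))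

/-- `Y` is a symmetric partial `A`-comodule coalgebra via `ρ`. With `T' (a ⊗ y) = (a ⊗ 1)ρ(y)`,
which has to lie in `A ⊗ Y`, the additional conditions are

* `(T' ⊗ ι)(a ⊗ Δ(y)) (1 ⊗ y' ⊗ 1)` lies in `A ⊗ Y ⊗ Y`;
* `(ι ⊗ T')(ι ⊗ τ)(T' ⊗ ι)(ι ⊗ τ)(Δ ⊗ ι) = ((ι ⊗ ε)T' ⊗ ι ⊗ ι)(ι ⊗ τ)((Δ ⊗ ι)T' ⊗ ι)(ι ⊗ Δ)`, with
  `τ` the flips: an equality of multipliers, stated for their products with `1 ⊗ a' ⊗ 1` on the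
  left and `1 ⊗ 1 ⊗ y'` on the right.

The element `s` is the product `(T' ⊗ ι)(a ⊗ Δ(y)) (1 ⊗ y' ⊗ 1)`. -/
structure IsSymmetricPartialComoduleCoalgebra (hA : IsMultiplierHopf ΔA)
    (hY : IsMultiplierHopf ΔY) (ρ : Y →ₗ[k] Mult k (A ⊗[k] Y)) : Prop extends
    IsPartialComoduleCoalgebra hA hY ρ where
  cover' : ∀ (a : A) (y : Y), InAlg ((ofElt k A a).tmul (1 : Mult k Y) * ρ y)
  mem' : ∀ (a : A) (y y' : Y),
    InAlg (hY.tensorId (coactT' ρ cover' ∘ₗ TensorProduct.mk k A Y a) y *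
      ((1 : Mult k A).tmul (ofElt k Y y')).tmul (1 : Mult k Y))
  coassoc' : ∀ (a a' : A) (y y' : Y) (s : (A ⊗[k] Y) ⊗[k] Y),
    ofElt k _ s = hY.tensorId (coactT' ρ cover' ∘ₗ TensorProduct.mk k A Y a) y *
      ((1 : Mult k A).tmul (ofElt k Y y')).tmul (1 : Mult k Y) →
    -- `(ι ⊗ T')(ι ⊗ τ)(T' ⊗ ι)(ι ⊗ τ)((1 ⊗ a')Δ(a) ⊗ y) (1 ⊗ 1 ⊗ y')`
    ((1 : Mult k A).tmul ((1 : Mult k A).tmul (ofElt k Y y'))).R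
        ((coactT' ρ cover').lTensor A
          ((TensorProduct.comm k Y A).toLinearMap.lTensor A
            (TensorProduct.assoc k A Y A ((coactT' ρ cover').rTensor A
              ((TensorProduct.assoc k A Y A).symm
                ((TensorProduct.comm k A Y).toLinearMap.lTensor A
                  (TensorProduct.assoc k A A Y (hA.T₄ (a' ⊗ₜ a) ⊗ₜ y)))))))) =
      -- `((ι ⊗ ε)T' ⊗ ι ⊗ ι)(ι ⊗ τ)((1 ⊗ a')Δ( ) ⊗ ι ⊗ ι)(s)`
      (idTensorCounit A hY ∘ₗ coactT' ρ cover').rTensor (A ⊗[k] Y)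
        ((TensorProduct.assoc k A Y (A ⊗[k] Y)).symm
          ((TensorProduct.comm k (A ⊗[k] Y) Y).toLinearMap.lTensor A
            (TensorProduct.assoc k A (A ⊗[k] Y) Y
              ((TensorProduct.assoc k A A Y).toLinearMap.rTensor Y
                (((hA.T₄ ∘ₗ TensorProduct.mk k A A a').rTensor Y).rTensor Y s)))))

/-- The linear map `ρ(y) = h ⊗ y`, for `h ∈ M(A)`. -/
def coactOf (h : Mult k A) : Y →ₗ[k] Mult k (A ⊗[k] Y) :=
  Mult.tmulₗ h ∘ₗ (ofElt k Y : Y →ₗ[k] Mult k Y)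

end Coaction

end MultHopf

end

/-! For `ρ(y) = h ⊗ y` the canonical maps are `T(y ⊗ a) = ha ⊗ y` and `T'(a ⊗ y) = ah ⊗ y`, so every
axiom becomes an identity about `h` in the legs belonging to `A`, tensored with something in the
legs belonging to `Y` that does not involve `h`.

The counit axiom reads `ε(h) y = y`, which is (i) because `Y ≠ 0` (`extend_counit_coactOf_eq_iff`).
The membership axioms are automatic: `(ι ⊗ T)(Δ(y) ⊗ a)` is `Δ(y)` with `ha` inserted between its
legs, and covering by `y'` reduces to a cover of `Δ(y)` itself (`idTensor_mul`, `mul_idTensor`,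
`tensorId_mul`).

Multiplied on the right by `1 ⊗ a' ⊗ y'`, the coassociativity axiom compares `(h ⊗ h)Δ(a)(1 ⊗ a') ⊗
yy'` with `(h ⊗ 1)Δ(ha)(1 ⊗ a') ⊗ yy'`; on the right-hand side the counit of `Y` has collapsed
`Δ(y)(1 ⊗ y')` to `yy'`. Since `Δ(ha) = Δ(h)Δ(a)`, since the elements `Δ(a)(1 ⊗ a')` span `A ⊗ A`,
and since some product `yy'` is nonzero, this is exactly (ii). The symmetric axiom gives (iii) in
the same way, with `h` acting on `(1 ⊗ a')Δ(a)` from the right.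

The comultiplication axiom compares `ha ⊗ Δ(y)` with `h²a ⊗ Δ(y)`, so it asks for `h² = h`. This is
no extra condition: applying `ι ⊗ ε` to (ii) and using (i) gives `h = h²`
(`mul_self_of_tmul_self_eq`). -/

namespace MultHopf

/-! ### Multipliers of tensor products and cancellation of a tensor factor. -/

section MultiplierTensor

variable {k : Type*} [Field k]
variable {A : Type*} [NonUnitalRing A] [Module k A] [IsScalarTower k A A] [SMulCommClass k A A]
variable {B : Type*} [NonUnitalRing B] [Module k B] [IsScalarTower k B B] [SMulCommClass k B B]

theorem Mult.ext_R [NondegenerateAlgebra A] {m n : Mult k A} (h : m.R = n.R) : m = n := by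
  refine Mult.ext_L (LinearMap.ext fun b => ?_)
  rw [← sub_eq_zero]
  refine NondegenerateAlgebra.eq_zero_of_mul_left _ fun a => ?_
  rw [mul_sub, Mult.compat, Mult.compat, h, sub_self]

theorem exists_mul_ne_zero (A : Type*) [NonUnitalRing A] [NondegenerateAlgebra A]
    [Nontrivial A] : ∃ a b : A, a * b ≠ 0 := by
  by_contra! hne
  obtain ⟨a, ha⟩ := exists_ne (0 : A)
  exact ha (NondegenerateAlgebra.eq_zero_of_mul_right a (hne a))

@[simp] theorem Mult.L_tmul_tmul (m : Mult k A) (n : Mult k B) (a : A) (b : B) :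
    (m.tmul n).L (a ⊗ₜ b) = m.L a ⊗ₜ n.L b := rfl

@[simp] theorem Mult.R_tmul_tmul (m : Mult k A) (n : Mult k B) (a : A) (b : B) :
    (m.tmul n).R (a ⊗ₜ b) = m.R a ⊗ₜ n.R b := rfl

theorem Mult.tmul_mul_tmul (m m' : Mult k A) (n n' : Mult k B) :
    m.tmul n * m'.tmul n' = (m * m').tmul (n * n') :=
  Mult.ext' (TensorProduct.ext' fun _ _ => rfl) (TensorProduct.ext' fun _ _ => rfl)

theorem ofElt_tmul (a : A) (b : B) :
    ofElt k (A ⊗[k] B) (a ⊗ₜ b) = (ofElt k A a).tmul (ofElt k B b) :=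
  Mult.ext' (TensorProduct.ext' fun c d => by simp) (TensorProduct.ext' fun c d => by simp)

/-- Over a field some functional does not vanish on `b`, and contracting the second factor with it
recovers the first up to a nonzero scalar. This is how the factor `yy'` is stripped from the
coassociativity axioms. -/
theorem tmul_right_cancel {k V W : Type*} [Field k] [AddCommGroup V] [Module k V]
    [AddCommGroup W] [Module k W] {b : W} (hb : b ≠ 0) {x y : V} (h : x ⊗ₜ[k] b = y ⊗ₜ[k] b) :
    x = y := by
  obtain ⟨ω, hω⟩ := Module.Projective.exists_dual_ne_zero k hb
  have := congrArg (fun t => TensorProduct.rid k V (ω.lTensor V t)) h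
  simpa [hω] using this

end MultiplierTensor

/-! ### Extensions of nondegenerate homomorphisms to multiplier algebras. -/

section Extension

variable {k : Type*} [Field k]
variable {A : Type*} [NonUnitalRing A] [Module k A] [IsScalarTower k A A] [SMulCommClass k A A]
variable {B : Type*} [NonUnitalRing B] [Module k B] [IsScalarTower k B B] [SMulCommClass k B B]
variable [NondegenerateAlgebra A] [NondegenerateAlgebra B]

theorem extend_ofElt {f : A →ₙₐ[k] Mult k B} (hf : IsNondegenerateHom f) (a : A) :
    extend hf (ofElt k A a) = f a :=
  (existsUnique_extension hf).choose_spec.1 a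

theorem extend_mul_apply {f : A →ₙₐ[k] Mult k B} (hf : IsNondegenerateHom f) (m : Mult k A)
    (a : A) : extend hf m * f a = f (m.L a) := by
  rw [← extend_ofElt hf, ← map_mul, mul_ofElt, extend_ofElt]

theorem apply_mul_extend {f : A →ₙₐ[k] Mult k B} (hf : IsNondegenerateHom f) (m : Mult k A)
    (a : A) : f a * extend hf m = f (m.R a) := by
  rw [← extend_ofElt hf, ← map_mul, ofElt_mul, extend_ofElt]

theorem eq_of_mul_eq' {f : A →ₙₐ[k] Mult k B}
    (hf : IsNondegenerateHom f) {F G : Mult k B} (h : ∀ a, f a * F = f a * G) : F = G := by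
  refine Mult.ext_R (LinearMap.ext_on hf.span_right ?_)
  rintro _ ⟨a, b, rfl⟩
  rw [← Mult.R_mul, ← Mult.R_mul, h]

end Extension

/-! ### The extended comultiplication and counit of a multiplier Hopf algebra. -/

section Comultiplication

variable {k : Type*} [Field k]
variable {A : Type*} [NonUnitalRing A] [Module k A] [IsScalarTower k A A] [SMulCommClass k A A]
variable [NondegenerateAlgebra A] {Δ : A →ₙₐ[k] Mult k (A ⊗[k] A)}

theorem comulMult_mul (hA : IsMultiplierHopf Δ) (m : Mult k A) (a : A) :
    comulMult hA m * Δ a = Δ (m.L a) := extend_mul_apply _ m a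

theorem mul_comulMult (hA : IsMultiplierHopf Δ) (m : Mult k A) (a : A) :
    Δ a * comulMult hA m = Δ (m.R a) := apply_mul_extend _ m a

theorem counit_L [Nontrivial A] (hA : IsMultiplierHopf Δ) (m : Mult k A) (a : A) :
    counit hA (m.L a) = counitMult hA m * counit hA a := by
  have h1 := congrArg (fun x => x.L (1 : k))
    (extend_mul_apply (isNondegenerateHom_counitHom hA) m a)
  -- A multiplier of the field is multiplication by its value at `1`, which is the scalar that
  -- `counitMult` reads off.
  have h2 : ∀ (m : Mult k k) (r : k), m.L r = m.L 1 * r := fun m r => by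
    rw [← Mult.L_mul_elt, one_mul]
  have h3 : ∀ b, (counitHom hA b).L 1 = counit hA b := fun b => mul_one _
  simp only [Mult.L_mul, h3] at h1
  rw [← h1, h2]
  rfl

/-- `(ι ⊗ ε)(Δ(a)(b ⊗ 1)) = ab`. -/
theorem counit_T₃ (hA : IsMultiplierHopf Δ) (a b : A) :
    TensorProduct.rid k A ((counit hA : A →ₗ[k] k).lTensor A (hA.T₃ (a ⊗ₜ b))) = a * b := by
  -- The defining identities of the counit concern `T₁` and `T₂` only. Multiplying by a further `c`
  -- on the left turns the claim into one about `(c ⊗ 1)Δ(a)(b ⊗ 1)`, where `ι ⊗ ε` lets both outer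
  -- factors out and the identity for `T₂` applies.
  rw [← sub_eq_zero]
  refine NondegenerateAlgebra.eq_zero_of_mul_left _ fun c => ?_
  have h1 : ∀ u : A ⊗[k] A,
      c * TensorProduct.rid k A ((counit hA : A →ₗ[k] k).lTensor A u) =
      TensorProduct.rid k A ((counit hA : A →ₗ[k] k).lTensor A
        (((ofElt k A c).tmul (1 : Mult k A)).L u)) := by
    intro u
    induction u with
    | zero => simp
    | add u v hu hv => simp only [map_add, mul_add, hu, hv]
    | tmul p q => simp [mul_smul_comm]
  have h2 : ∀ u : A ⊗[k] A,
      TensorProduct.rid k A ((counit hA : A →ₗ[k] k).lTensor A u) * b =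
      TensorProduct.rid k A ((counit hA : A →ₗ[k] k).lTensor A
        (((ofElt k A b).tmul (1 : Mult k A)).R u)) := by
    intro u
    induction u with
    | zero => simp
    | add u v hu hv => simp only [map_add, add_mul, hu, hv]
    | tmul p q => simp [smul_mul_assoc]
  have h3 : ((ofElt k A c).tmul (1 : Mult k A)).L (hA.T₃ (a ⊗ₜ b)) =
      ((ofElt k A b).tmul (1 : Mult k A)).R (hA.T₂ (c ⊗ₜ a)) := by
    apply ofElt_injective (k := k)
    rw [← mul_ofElt, ← ofElt_mul, hA.ofElt_T₃, hA.ofElt_T₂, mul_assoc]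
  rw [mul_sub, h1, h3, ← h2, (isCounit_counit hA).right, mul_assoc, sub_self]

/-- The elements `Δ(a)(1 ⊗ b)` separate multipliers of `A ⊗ A` acting on the left. -/
theorem eq_iff_L_T₁ (hA : IsMultiplierHopf Δ) (F G : Mult k (A ⊗[k] A)) :
    F = G ↔ ∀ a b : A, F.L (hA.T₁ (a ⊗ₜ b)) = G.L (hA.T₁ (a ⊗ₜ b)) := by
  refine ⟨fun h _ _ => by rw [h], fun h => Mult.ext_L (LinearMap.ext fun u => ?_)⟩
  obtain ⟨v, rfl⟩ := hA.bijective_T₁.2 u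
  induction v with
  | zero => simp
  | add v w hv hw => simp only [map_add, hv, hw]
  | tmul a b => exact h a b

/-- This is `Δ(m)Δ(a) = Δ(ma)` in covered form. It lets the term `Δ(ha)` in the coassociativity
axiom be read as `Δ(h)` acting on `Δ(a)(1 ⊗ a')`. -/
theorem comulMult_L_T₁ (hA : IsMultiplierHopf Δ) (m : Mult k A) (a b : A) :
    (comulMult hA m).L (hA.T₁ (a ⊗ₜ b)) = hA.T₁ (m.L a ⊗ₜ b) := by
  apply ofElt_injective (k := k)
  rw [← mul_ofElt, hA.ofElt_T₁, hA.ofElt_T₁, ← mul_assoc, comulMult_mul]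

/-- The elements `(1 ⊗ a)Δ(b)` separate multipliers of `A ⊗ A` acting on the right. -/
theorem eq_iff_R_T₄ (hA : IsMultiplierHopf Δ) (F G : Mult k (A ⊗[k] A)) :
    F = G ↔ ∀ a b : A, F.R (hA.T₄ (a ⊗ₜ b)) = G.R (hA.T₄ (a ⊗ₜ b)) := by
  -- Surjectivity of `T₄` is not part of `IsMultiplierHopf`, so the argument used for `T₁` has no
  -- direct mirror. Instead nondegeneracy of `Δ` reduces the claim to `Δ(b)F = Δ(b)G`, which is
  -- tested on `c ⊗ a`: here `(c ⊗ a)Δ(b)` is `c ⊗ 1` times `(1 ⊗ a)Δ(b)`, and multiplication by `c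
  -- ⊗ 1` on the left commutes with the action of `F` and `G` on the right.
  refine ⟨fun h _ _ => by rw [h], fun h => eq_of_mul_eq' hA.nondegenerate fun b => ?_⟩
  refine Mult.ext_R (TensorProduct.ext' fun c a => ?_)
  have h1 : (Δ b).R (c ⊗ₜ a) =
      ((ofElt k A c).tmul (1 : Mult k A)).L (hA.T₄ (a ⊗ₜ b)) := by
    apply ofElt_injective (k := k)
    rw [← mul_ofElt, ← ofElt_mul, hA.ofElt_T₄, ofElt_tmul, ← mul_assoc, Mult.tmul_mul_tmul,
      mul_one, one_mul]
  have h2 : ∀ H : Mult k (A ⊗[k] A), (Δ b * H).R (c ⊗ₜ a) =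
      ((ofElt k A c).tmul (1 : Mult k A)).L (H.R (hA.T₄ (a ⊗ₜ b))) := by
    intro H
    rw [Mult.R_mul, h1]
    apply ofElt_injective (k := k)
    rw [← mul_ofElt, ← ofElt_mul, ← ofElt_mul, ← mul_ofElt, mul_assoc]
  rw [h2, h2, h]

theorem comulMult_R_T₄ (hA : IsMultiplierHopf Δ) (m : Mult k A) (a b : A) :
    (comulMult hA m).R (hA.T₄ (a ⊗ₜ b)) = hA.T₄ (a ⊗ₜ m.R b) := by
  apply ofElt_injective (k := k)
  rw [← ofElt_mul, hA.ofElt_T₄, hA.ofElt_T₄, mul_assoc, mul_comulMult]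

/-- An element `h` of counit one with `h ⊗ h = (h ⊗ 1)Δ(h)` is idempotent. -/
theorem mul_self_of_tmul_self_eq [Nontrivial A] (hA : IsMultiplierHopf Δ) {h : Mult k A}
    (h1 : counitMult hA h = 1) (h2 : h.tmul h = h.tmul 1 * comulMult hA h) : h * h = h := by
  -- Used with `m = h` and `m = 1`, both of counit one, so that `ι ⊗ ε` turns `h ⊗ h` and `h ⊗ 1`
  -- alike into left multiplication by `h`.
  have hm : ∀ (m : Mult k A) (u : A ⊗[k] A),
      TensorProduct.rid k A ((counit hA : A →ₗ[k] k).lTensor A ((h.tmul m).L u)) =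
      counitMult hA m •
        h.L (TensorProduct.rid k A ((counit hA : A →ₗ[k] k).lTensor A u)) := by
    intro m u
    induction u with
    | zero => simp
    | add u v hu hv => simp only [map_add, smul_add, hu, hv]
    | tmul p q => simp [counit_L, mul_smul]
  have hone : counitMult hA (1 : Mult k A) = 1 := by simp [counitMult]
  -- The hypothesis is covered by `Δ(a)(b ⊗ 1)`, not by `Δ(a)(1 ⊗ b)`, because `ι ⊗ ε` leaves the
  -- first leg and sends the former to `ab`. Cancelling `b` afterwards gives `h = h²`.
  have h3 : ∀ a b : A, h.L (a * b) = h.L (h.L a * b) := by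
    intro a b
    have h4 : (h.tmul h).L (hA.T₃ (a ⊗ₜ b)) = (h.tmul 1).L (hA.T₃ (h.L a ⊗ₜ b)) := by
      apply ofElt_injective (k := k)
      rw [← mul_ofElt, ← mul_ofElt, hA.ofElt_T₃, hA.ofElt_T₃, ← comulMult_mul hA, h2]
      simp only [mul_assoc]
    have h5 := congrArg
      (fun u => TensorProduct.rid k A ((counit hA : A →ₗ[k] k).lTensor A u)) h4
    simpa only [hm, h1, hone, one_smul, counit_T₃] using h5
  refine Mult.ext_L (LinearMap.ext fun a => ?_)
  rw [← sub_eq_zero]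
  refine NondegenerateAlgebra.eq_zero_of_mul_right _ fun b => ?_
  rw [sub_mul, Mult.L_mul, ← Mult.L_mul_elt h (h.L a), ← h3, Mult.L_mul_elt, sub_self]

end Comultiplication

/-! ### The canonical maps and the counit axiom for the coaction by `h`. -/

section CoactOf

variable {k : Type*} [Field k]
variable {A : Type*} [NonUnitalRing A] [Module k A] [IsScalarTower k A A] [SMulCommClass k A A]
variable {Y : Type*} [NonUnitalRing Y] [Module k Y] [IsScalarTower k Y Y] [SMulCommClass k Y Y]

theorem coactOf_apply (h : Mult k A) (y : Y) : coactOf h y = h.tmul (ofElt k Y y) := rfl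

variable [NondegenerateAlgebra A]

theorem coactOf_mul (h : Mult k A) (y : Y) (a : A) :
    coactOf h y * (ofElt k A a).tmul (1 : Mult k Y) = ofElt k _ (h.L a ⊗ₜ y) := by
  rw [coactOf_apply, Mult.tmul_mul_tmul, mul_ofElt, mul_one, ofElt_tmul]

theorem mul_coactOf (h : Mult k A) (a : A) (y : Y) :
    (ofElt k A a).tmul (1 : Mult k Y) * coactOf h y = ofElt k _ (h.R a ⊗ₜ y) := by
  rw [coactOf_apply, Mult.tmul_mul_tmul, ofElt_mul, one_mul, ofElt_tmul]

theorem inAlg_coactOf_mul (h : Mult k A) (y : Y) (a : A) :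
    InAlg (coactOf h y * (ofElt k A a).tmul (1 : Mult k Y)) := ⟨_, (coactOf_mul h y a).symm⟩

theorem inAlg_mul_coactOf (h : Mult k A) (a : A) (y : Y) :
    InAlg ((ofElt k A a).tmul (1 : Mult k Y) * coactOf h y) := ⟨_, (mul_coactOf h a y).symm⟩

variable [NondegenerateAlgebra Y]
variable {ΔA : A →ₙₐ[k] Mult k (A ⊗[k] A)} {ΔY : Y →ₙₐ[k] Mult k (Y ⊗[k] Y)}

@[simp] theorem coactT_coactOf (h : Mult k A) (hρ) (y : Y) (a : A) :
    coactT (coactOf h) hρ (y ⊗ₜ a) = h.L a ⊗ₜ y := by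
  apply ofElt_injective (k := k)
  rw [← coactOf_mul]
  simp [coactT, ofElt_descend]

@[simp] theorem coactT'_coactOf (h : Mult k A) (hρ) (a : A) (y : Y) :
    coactT' (coactOf h) hρ (a ⊗ₜ y) = h.R a ⊗ₜ y := by
  apply ofElt_injective (k := k)
  rw [← mul_coactOf]
  simp [coactT', ofElt_descend]

/-- In this form the maps fed to `idTensor` and `tensorId` only insert a fixed element of `A`, so
the computations with them can be carried out for an arbitrary `x` in place of `ha` or `ah`. -/
theorem coactT_coactOf_comp (h : Mult k A) (hρ) (a : A) :
    coactT (coactOf h) hρ ∘ₗ (TensorProduct.mk k Y A).flip a = TensorProduct.mk k A Y (h.L a) :=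
  LinearMap.ext fun y => by simp

theorem coactT'_coactOf_comp (h : Mult k A) (hρ) (a : A) :
    coactT' (coactOf h) hρ ∘ₗ TensorProduct.mk k A Y a = TensorProduct.mk k A Y (h.R a) :=
  LinearMap.ext fun y => by simp

theorem extend_counit_coactOf_eq_iff [Nontrivial A] [Nontrivial Y] (hA : IsMultiplierHopf ΔA)
    (hY : IsMultiplierHopf ΔY) (h : Mult k A) :
    (∀ y : Y, extend (isNondegenerateHom_counitTensorHom hA hY) (coactOf h y) = ofElt k Y y) ↔
      counitMult hA h = 1 := by
  -- The extension is determined by its products with the values `ε(b) z` of `ε ⊗ ι`, and there the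
  -- claim is `ε(hb) = ε(h)ε(b)`.
  have h1 : ∀ y : Y, extend (isNondegenerateHom_counitTensorHom hA hY) (coactOf h y) =
      counitMult hA h • ofElt k Y y := by
    intro y
    refine eq_of_mul_eq (isNondegenerateHom_counitTensorHom hA hY) fun u => ?_
    rw [extend_mul_apply]
    have h2 : ∀ (b : A) (z : Y), (counitTensorHom hA : A ⊗[k] Y →ₙₐ[k] Mult k Y) (b ⊗ₜ z) =
        counit hA b • ofElt k Y z := fun b z => map_smul (ofElt k Y) (counit hA b) z
    induction u with
    | zero => simp
    | add u v hu hv => simp only [map_add, mul_add, hu, hv]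
    | tmul b z =>
      rw [coactOf_apply, Mult.L_tmul_tmul, h2, h2, counit_L, L_ofElt, map_mul,
        smul_mul_smul_comm]
  refine ⟨fun h2 => ?_, fun h2 y => by rw [h1, h2, one_smul]⟩
  obtain ⟨y, hy⟩ := exists_ne (0 : Y)
  have h3 := h2 y
  rw [h1, ← map_smul] at h3
  exact smul_left_injective k hy ((ofElt_injective h3).trans (one_smul k y).symm)

/-! ### The multipliers obtained by inserting an element of `A` into `Δ(y)`. -/

theorem idTensor_L (hY : HasCovers ΔY) (x b : A) (y p c : Y) :
    (hY.idTensor (TensorProduct.mk k A Y x) y).L (p ⊗ₜ (b ⊗ₜ c)) =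
      (TensorProduct.mk k A Y (x * b)).lTensor Y ((ΔY y).L (p ⊗ₜ c)) := by
  have h1 : (ΔY y).L (p ⊗ₜ c) =
      ((1 : Mult k Y).tmul (ofElt k Y c)).R (hY.T₃ (y ⊗ₜ p)) := by
    apply ofElt_injective (k := k)
    rw [← mul_ofElt, ← ofElt_mul, hY.ofElt_T₃, ofElt_tmul, mul_assoc, Mult.tmul_mul_tmul,
      mul_one, one_mul]
  rw [h1]
  -- This unfolds the construction of `idTensor`: it is specified by its products with `p ⊗ 1`, and
  -- the factor `b ⊗ c` is then multiplied on the right.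
  change ((1 : Mult k Y).tmul (ofElt k (A ⊗[k] Y) (b ⊗ₜ c))).R
    ((TensorProduct.mk k A Y x).lTensor Y (hY.T₃ (y ⊗ₜ p))) = _
  generalize hY.T₃ (y ⊗ₜ p) = u
  induction u with
  | zero => simp
  | add u v hu hv => simp only [map_add, hu, hv]
  | tmul q r => simp

/-- Since `x` already lies in `A`, only the legs of `Δ(y)` need covering, and `1 ⊗ y'` does that.
Besides giving the membership axiom, this identifies the element `t` in the axioms by injectivity of
`ofElt`. -/
theorem idTensor_mul (hY : HasCovers ΔY) (x : A) (y y' : Y) :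
    hY.idTensor (TensorProduct.mk k A Y x) y *
        (1 : Mult k Y).tmul ((1 : Mult k A).tmul (ofElt k Y y')) =
      ofElt k _ ((TensorProduct.mk k A Y x).lTensor Y (hY.T₁ (y ⊗ₜ y'))) := by
  refine Mult.ext_L (TensorProduct.ext_threefold' fun p b c => ?_)
  rw [Mult.L_mul, Mult.L_tmul_tmul, Mult.L_tmul_tmul, L_ofElt, Mult.L_one, Mult.L_one,
    LinearMap.id_apply, LinearMap.id_apply, idTensor_L, L_ofElt]
  have h1 : (ΔY y).L (p ⊗ₜ (y' * c)) = hY.T₁ (y ⊗ₜ y') * (p ⊗ₜ c) := by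
    apply ofElt_injective (k := k)
    rw [map_mul, hY.ofElt_T₁, ← mul_ofElt, ofElt_tmul, ofElt_tmul, mul_assoc,
      Mult.tmul_mul_tmul, one_mul, map_mul]
  rw [h1]
  generalize hY.T₁ (y ⊗ₜ y') = u
  induction u with
  | zero => simp
  | add u v hu hv => simp only [map_add, add_mul, hu, hv]
  | tmul q r => simp

theorem mul_idTensor (hY : HasCovers ΔY) (x : A) (y y' : Y) :
    (1 : Mult k Y).tmul ((1 : Mult k A).tmul (ofElt k Y y')) *
        hY.idTensor (TensorProduct.mk k A Y x) y =
      ofElt k _ ((TensorProduct.mk k A Y x).lTensor Y (hY.T₄ (y' ⊗ₜ y))) := by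
  refine Mult.ext_L (TensorProduct.ext_threefold' fun p b c => ?_)
  rw [Mult.L_mul, idTensor_L, L_ofElt]
  have h1 : ((1 : Mult k Y).tmul (ofElt k Y y')).L ((ΔY y).L (p ⊗ₜ c)) =
      hY.T₄ (y' ⊗ₜ y) * (p ⊗ₜ c) := by
    apply ofElt_injective (k := k)
    rw [map_mul, hY.ofElt_T₄, ← mul_ofElt, ← mul_ofElt, mul_assoc]
  have h2 : ∀ u : Y ⊗[k] Y, ((1 : Mult k Y).tmul ((1 : Mult k A).tmul (ofElt k Y y'))).L
      ((TensorProduct.mk k A Y (x * b)).lTensor Y u) =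
      (TensorProduct.mk k A Y (x * b)).lTensor Y (((1 : Mult k Y).tmul (ofElt k Y y')).L u) := by
    intro u
    induction u with
    | zero => simp
    | add u v hu hv => simp only [map_add, hu, hv]
    | tmul q r => simp
  rw [h2, h1]
  generalize hY.T₄ (y' ⊗ₜ y) = u
  induction u with
  | zero => simp
  | add u v hu hv => simp only [map_add, add_mul, hu, hv]
  | tmul q r => simp

theorem tensorId_L (hY : HasCovers ΔY) (x b : A) (y c d : Y) :
    (hY.tensorId (TensorProduct.mk k A Y x) y).L ((b ⊗ₜ c) ⊗ₜ d) =
      (TensorProduct.mk k A Y (x * b)).rTensor Y ((ΔY y).L (c ⊗ₜ d)) := by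
  have h1 : (ΔY y).L (c ⊗ₜ d) =
      ((ofElt k Y c).tmul (1 : Mult k Y)).R (hY.T₁ (y ⊗ₜ d)) := by
    apply ofElt_injective (k := k)
    rw [← mul_ofElt, ← ofElt_mul, hY.ofElt_T₁, ofElt_tmul, mul_assoc, Mult.tmul_mul_tmul,
      mul_one, one_mul]
  rw [h1]
  -- The flips appear because the completion on the right tensor factor is defined by transporting
  -- the one on the left.
  change TensorProduct.comm k Y (A ⊗[k] Y)
    (((1 : Mult k Y).tmul (ofElt k (A ⊗[k] Y) (b ⊗ₜ c))).R
      (TensorProduct.comm k (A ⊗[k] Y) Y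
        ((TensorProduct.mk k A Y x).rTensor Y (hY.T₁ (y ⊗ₜ d))))) = _
  generalize hY.T₁ (y ⊗ₜ d) = u
  induction u with
  | zero => simp
  | add u v hu hv => simp only [map_add, hu, hv]
  | tmul q r => simp

theorem tensorId_mul (hY : HasCovers ΔY) (x : A) (y y' : Y) :
    hY.tensorId (TensorProduct.mk k A Y x) y *
        ((1 : Mult k A).tmul (ofElt k Y y')).tmul (1 : Mult k Y) =
      ofElt k _ ((TensorProduct.mk k A Y x).rTensor Y (hY.T₃ (y ⊗ₜ y'))) := by
  refine Mult.ext_L (TensorProduct.ext_threefold fun b c d => ?_)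
  rw [Mult.L_mul, Mult.L_tmul_tmul, Mult.L_tmul_tmul, L_ofElt, Mult.L_one, Mult.L_one,
    LinearMap.id_apply, LinearMap.id_apply, tensorId_L, L_ofElt]
  have h1 : (ΔY y).L ((y' * c) ⊗ₜ d) = hY.T₃ (y ⊗ₜ y') * (c ⊗ₜ d) := by
    apply ofElt_injective (k := k)
    rw [map_mul, hY.ofElt_T₃, ← mul_ofElt, ofElt_tmul, ofElt_tmul, mul_assoc,
      Mult.tmul_mul_tmul, one_mul, map_mul]
  rw [h1]
  generalize hY.T₃ (y ⊗ₜ y') = u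
  induction u with
  | zero => simp
  | add u v hu hv => simp only [map_add, add_mul, hu, hv]
  | tmul q r => simp

/-! ### The two sides of the coassociativity and comultiplication axioms. -/

/-- `(ι ⊗ T)((T ⊗ ι)(y ⊗ v)) (1 ⊗ 1 ⊗ y') = (h ⊗ h)v ⊗ yy'` for `ρ(y) = h ⊗ y`. -/
theorem coassoc_lhs_coactOf (h : Mult k A) (hρ) (y y' : Y) (v : A ⊗[k] A) :
    ((1 : Mult k A).tmul ((1 : Mult k A).tmul (ofElt k Y y'))).R
        ((coactT (coactOf h) hρ).lTensor A (TensorProduct.assoc k A Y A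
          ((coactT (coactOf h) hρ).rTensor A ((TensorProduct.assoc k Y A A).symm (y ⊗ₜ v))))) =
      TensorProduct.assoc k A A Y ((h.tmul h).L v ⊗ₜ (y * y')) := by
  induction v with
  | zero => simp
  | add u v hu hv => simp only [map_add, TensorProduct.tmul_add, TensorProduct.add_tmul, hu, hv]
  | tmul a b => simp

/-- The right hand side of the coassociativity condition for `ρ(y) = h ⊗ y`. -/
theorem coassoc_rhs_coactOf (hY : IsMultiplierHopf ΔY) (h : Mult k A) (hρ) (x : A)
    (f : A →ₗ[k] A ⊗[k] A) (u : Y ⊗[k] Y) :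
    (idTensorCounit A hY ∘ₗ coactT (coactOf h) hρ).rTensor (A ⊗[k] Y)
        ((TensorProduct.assoc k Y A (A ⊗[k] Y)).symm
          ((TensorProduct.assoc k A A Y).toLinearMap.lTensor Y
            ((f.rTensor Y).lTensor Y ((TensorProduct.mk k A Y x).lTensor Y u)))) =
      TensorProduct.assoc k A A Y ((h.tmul 1).L (f x) ⊗ₜ
        TensorProduct.lid k Y ((counit hY : Y →ₗ[k] k).rTensor Y u)) := by
  induction u with
  | zero => simp
  | add u v hu hv => simp only [map_add, TensorProduct.tmul_add, hu, hv]
  | tmul p q =>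
    simp only [LinearMap.lTensor_tmul, LinearMap.rTensor_tmul, TensorProduct.mk_apply]
    generalize f x = w
    induction w with
    | zero => simp
    | add u v hu hv => simp only [map_add, TensorProduct.tmul_add, TensorProduct.add_tmul, hu, hv]
    -- On pure tensors `(ι ⊗ ε)T(p ⊗ a) = ε(p) ha`; moving the scalar onto `q` produces `(ε ⊗ ι)(p ⊗
    -- q)`.
    | tmul a b => simp [idTensorCounit, TensorProduct.smul_tmul']

/-- `(ι ⊗ T')(ι ⊗ τ)(T' ⊗ ι)(ι ⊗ τ)(v ⊗ y) (1 ⊗ 1 ⊗ y') = v(h ⊗ h) ⊗ yy'` for `ρ(y) = h ⊗ y`. -/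
theorem coassoc'_lhs_coactOf (h : Mult k A) (hρ) (y y' : Y) (v : A ⊗[k] A) :
    ((1 : Mult k A).tmul ((1 : Mult k A).tmul (ofElt k Y y'))).R
        ((coactT' (coactOf h) hρ).lTensor A
          ((TensorProduct.comm k Y A).toLinearMap.lTensor A
            (TensorProduct.assoc k A Y A ((coactT' (coactOf h) hρ).rTensor A
              ((TensorProduct.assoc k A Y A).symm
                ((TensorProduct.comm k A Y).toLinearMap.lTensor A
                  (TensorProduct.assoc k A A Y (v ⊗ₜ y)))))))) =
      TensorProduct.assoc k A A Y ((h.tmul h).R v ⊗ₜ (y * y')) := by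
  induction v with
  | zero => simp
  | add u v hu hv => simp only [map_add, TensorProduct.add_tmul, hu, hv]
  | tmul a b => simp

/-- The right hand side of the second coassociativity condition for `ρ(y) = h ⊗ y`. -/
theorem coassoc'_rhs_coactOf (hY : IsMultiplierHopf ΔY) (h : Mult k A) (hρ) (x : A)
    (f : A →ₗ[k] A ⊗[k] A) (u : Y ⊗[k] Y) :
    (idTensorCounit A hY ∘ₗ coactT' (coactOf h) hρ).rTensor (A ⊗[k] Y)
        ((TensorProduct.assoc k A Y (A ⊗[k] Y)).symm
          ((TensorProduct.comm k (A ⊗[k] Y) Y).toLinearMap.lTensor A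
            (TensorProduct.assoc k A (A ⊗[k] Y) Y
              ((TensorProduct.assoc k A A Y).toLinearMap.rTensor Y
                ((f.rTensor Y).rTensor Y ((TensorProduct.mk k A Y x).rTensor Y u)))))) =
      TensorProduct.assoc k A A Y ((h.tmul 1).R (f x) ⊗ₜ
        TensorProduct.rid k Y ((counit hY : Y →ₗ[k] k).lTensor Y u)) := by
  induction u with
  | zero => simp
  | add u v hu hv => simp only [map_add, TensorProduct.tmul_add, hu, hv]
  | tmul p q =>
    simp only [LinearMap.rTensor_tmul, LinearMap.lTensor_tmul, TensorProduct.mk_apply]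
    generalize f x = w
    induction w with
    | zero => simp
    | add u v hu hv => simp only [map_add, TensorProduct.add_tmul, hu, hv]
    -- The flip brings the second leg `q` next to `a`, so here the counit falls on `q` and `(ι ⊗
    -- ε)(p ⊗ q)` remains.
    | tmul a b => simp [idTensorCounit, TensorProduct.smul_tmul']

/-- Applied with `x = ha`, this yields the `h²a` on the right-hand side of the comultiplication
axiom. -/
theorem rTensor_coactT_coactOf (h : Mult k A) (hρ) (x : A) (u : Y ⊗[k] Y) :
    TensorProduct.assoc k A Y Y ((coactT (coactOf h) hρ).rTensor Y
        ((TensorProduct.assoc k Y A Y).symm ((TensorProduct.mk k A Y x).lTensor Y u))) =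
      h.L x ⊗ₜ u := by
  induction u with
  | zero => simp
  | add u v hu hv => simp only [map_add, TensorProduct.tmul_add, hu, hv]
  | tmul p q => simp

/-! ### The two equivalences. -/

variable [Nontrivial A]

theorem isPartialComoduleCoalgebra_coactOf_iff [Nontrivial Y] (hA : IsMultiplierHopf ΔA)
    (hY : IsMultiplierHopf ΔY) (h : Mult k A) :
    IsPartialComoduleCoalgebra hA hY (coactOf (Y := Y) h) ↔
      counitMult hA h = 1 ∧ h.tmul h = h.tmul 1 * comulMult hA h := by
  constructor
  · intro H
    refine ⟨(extend_counit_coactOf_eq_iff hA hY h).1 H.counit_coact, ?_⟩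
    rw [eq_iff_L_T₁ hA]
    intro a a'
    obtain ⟨y, y', hy⟩ := exists_mul_ne_zero Y
    -- The cover `t` is the explicit tensor supplied by `idTensor_mul`; the counit of `Y` then turns
    -- the right-hand side into a tensor with the same factor `yy'` as the left.
    have h1 := H.coassoc y y' a a' _
      (by rw [coactT_coactOf_comp]; exact (idTensor_mul _ _ _ _).symm)
    rw [coassoc_lhs_coactOf, coassoc_rhs_coactOf, (isCounit_counit hY).left] at h1
    rw [Mult.L_mul, comulMult_L_T₁]
    exact tmul_right_cancel hy ((TensorProduct.assoc k A A Y).injective h1)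
  · rintro ⟨h1, h2⟩
    -- Idempotency serves the two covered forms of the comultiplication axiom.
    have hh : ∀ a, h.L (h.L a) = h.L a := fun a => by
      rw [← Mult.L_mul, mul_self_of_tmul_self_eq hA h1 h2]
    refine
      { cover := inAlg_coactOf_mul h
        counit_coact := (extend_counit_coactOf_eq_iff hA hY h).2 h1
        mem_right := fun y y' a => ?_
        mem_left := fun y y' a => ?_
        comul_right := fun y y' a t ht => ?_
        comul_left := fun y y' a t ht => ?_
        coassoc := fun y y' a a' t ht => ?_ }
    · rw [coactT_coactOf_comp, idTensor_mul]
      exact ⟨_, rfl⟩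
    · rw [coactT_coactOf_comp, mul_idTensor]
      exact ⟨_, rfl⟩
    · rw [coactT_coactOf_comp, idTensor_mul] at ht
      rw [ofElt_injective ht, rTensor_coactT_coactOf, coactT_coactOf, hh, ofElt_tmul,
        hY.ofElt_T₁]
      exact (Mult.tmul_mul_tmul _ _ _ _).trans (by rw [mul_one])
    · rw [coactT_coactOf_comp, mul_idTensor] at ht
      rw [ofElt_injective ht, rTensor_coactT_coactOf, coactT_coactOf, hh, ofElt_tmul,
        hY.ofElt_T₄]
      exact (Mult.tmul_mul_tmul _ _ _ _).trans (by rw [one_mul])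
    · rw [coactT_coactOf_comp, idTensor_mul] at ht
      rw [ofElt_injective ht, coassoc_lhs_coactOf, coassoc_rhs_coactOf,
        (isCounit_counit hY).left, h2, Mult.L_mul, comulMult_L_T₁]
      rfl

theorem isSymmetricPartialComoduleCoalgebra_coactOf_iff [Nontrivial Y]
    (hA : IsMultiplierHopf ΔA) (hY : IsMultiplierHopf ΔY) (h : Mult k A) :
    IsSymmetricPartialComoduleCoalgebra hA hY (coactOf (Y := Y) h) ↔
      IsPartialComoduleCoalgebra hA hY (coactOf (Y := Y) h) ∧
        h.tmul h = comulMult hA h * h.tmul 1 := by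
  constructor
  · intro H
    refine ⟨H.toIsPartialComoduleCoalgebra, ?_⟩
    rw [eq_iff_R_T₄ hA]
    intro a' a
    obtain ⟨y, y', hy⟩ := exists_mul_ne_zero Y
    have h1 := H.coassoc' a a' y y' _
      (by rw [coactT'_coactOf_comp]; exact (tensorId_mul _ _ _ _).symm)
    -- The cover is now `Δ(y)(y' ⊗ 1)` and the counit acts on its second leg, so `counit_T₃` for `Y`
    -- is what supplies `yy'`.
    rw [coassoc'_lhs_coactOf, coassoc'_rhs_coactOf, counit_T₃] at h1
    rw [Mult.R_mul, comulMult_R_T₄]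
    exact tmul_right_cancel hy ((TensorProduct.assoc k A A Y).injective h1)
  · rintro ⟨H, h2⟩
    refine
      { H with
        cover' := inAlg_mul_coactOf h
        mem' := fun a y y' => ?_
        coassoc' := fun a a' y y' s hs => ?_ }
    · rw [coactT'_coactOf_comp, tensorId_mul]
      exact ⟨_, rfl⟩
    · rw [coactT'_coactOf_comp, tensorId_mul] at hs
      rw [ofElt_injective hs, coassoc'_lhs_coactOf, coassoc'_rhs_coactOf, counit_T₃, h2,
        Mult.R_mul, comulMult_R_T₄]
      rfl

end CoactOf

end MultHopf


theorem mainTheorem4 {k : Type*} [Field k]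
    {A : Type*} [NonUnitalRing A] [Module k A] [IsScalarTower k A A] [SMulCommClass k A A]
    [MultHopf.NondegenerateAlgebra A] [Nontrivial A]
    {Y : Type*} [NonUnitalRing Y] [Module k Y] [IsScalarTower k Y Y] [SMulCommClass k Y Y]
    [MultHopf.NondegenerateAlgebra Y] [Nontrivial Y]
    (ΔA : A →ₙₐ[k] MultHopf.Mult k (A ⊗[k] A)) (hA : MultHopf.IsRegularMultiplierHopf ΔA)
    (ΔY : Y →ₙₐ[k] MultHopf.Mult k (Y ⊗[k] Y)) (hY : MultHopf.IsRegularMultiplierHopf ΔY)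
    (h : MultHopf.Mult k A) :
    (MultHopf.IsPartialComoduleCoalgebra hA.toIsMultiplierHopf hY.toIsMultiplierHopf
        (MultHopf.coactOf (Y := Y) h) ↔
      MultHopf.counitMult hA.toIsMultiplierHopf h = 1 ∧
        h.tmul h = h.tmul 1 * MultHopf.comulMult hA.toIsMultiplierHopf h) ∧
    (MultHopf.IsSymmetricPartialComoduleCoalgebra hA.toIsMultiplierHopf hY.toIsMultiplierHopf
        (MultHopf.coactOf (Y := Y) h) ↔
      MultHopf.counitMult hA.toIsMultiplierHopf h = 1 ∧
        h.tmul h = h.tmul 1 * MultHopf.comulMult hA.toIsMultiplierHopf h ∧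
        h.tmul h = MultHopf.comulMult hA.toIsMultiplierHopf h * h.tmul 1) := by
  have hp := MultHopf.isPartialComoduleCoalgebra_coactOf_iff (Y := Y)
    hA.toIsMultiplierHopf hY.toIsMultiplierHopf h
  refine ⟨hp, ?_⟩
  rw [MultHopf.isSymmetricPartialComoduleCoalgebra_coactOf_iff, hp, and_assoc]
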